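/- Let $\{X_t\}$ and $\{W_t\}$, $t\ge 0$, be independent Markov chains with transition probabilities $P_1$, $P_2$ on measurable spaces $E_1$, $E_2$, satisfying $P_j(x,A)\ge s_j(x)\nu_j(A)$ for all $x$ and all measurable $A$, where $s_j\ge 0$ is measurable and $\nu_j$ is a probability measure ($j=1,2$). Assume that $\{X_t\}$ is $\phi_1$-irreducible and Harris recurrent, that $\{W_t\}$ is $\phi_2$-irreducible and ergodic with stationary probability measure $\pi_2$ (that is, $\pi_2P_2=\pi_2$ and $P_2^n(w,\cdot)\to\pi_2$ in total variation for every $w$), and that $\phi_j(s_j>0)>0$. Let $\{(X_t,Y^1_t)\}$ and $\{(W_t,Y^2_t)\}$ be the corresponding split chains, independent of each other: given the past and the current position $x$ of chain $j$, $Y^j_t$ equals $1$ with probability $s_j(x)$ and $0$ otherwise; the next position then has law $\nu_j$ if $Y^j_t=1$, and law $(P_j(x,\cdot)-s_j(x)\nu_j)/(1-s_j(x))$ (by convention $\delta_x$ if $s_j(x)=1$) if $Y^j_t=0$. Let $0\le\tau^1_0<\tau^1_1<\cdots$ be the successive times $t\ge 0$ with $Y^1_t=1$. The embedded chain is $\widetilde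 W_k=W_{\tau^1_k}$, $k\ge0$, with transition probability $$\widetilde P=P_2\sum_{\ell=0}^\infty\{\nu_1(P_1-s_1\otimes\nu_1)^\ell s_1\}\,P_2^\ell ,$$ and $\mathcal T=\inf\{j\ge 0: Y^2_{\tau^1_j}=1\}$. A transition probability $P$ is called geometrically ergodic with stationary law $\pi$ if it is ergodic with stationary law $\pi$ and there are $\rho\in(0,1)$ and a measurable $M\ge 0$ with $\int M\,d\pi<\infty$ such that $\|P^n(x,\cdot)-\pi\|\le M(x)\rho^n$ for all $x$ and all $n\ge0$. For a process $\{Z_t\}$ let $\alpha_\ell(Z)=\sup|\mathbb P(A\cap B)-\mathbb P(A)\mathbb P(B)|$, the supremum being over all $k\ge 0$, $A\in\sigma(Z_i,i\le k)$ and $B\in\sigma(Z_i,i\ge k+\ell)$; $\{Z_t\}$ is strongly mixing if $\alpha_\ell(Z)\to0$ as $\ell\to\infty$. 1. If $\{W_t\}$ is geometrically ergodic (with stationary law $\pi_2$), then so is the embedded chain: $\{\widetilde W_k\}$ is a Markov chain with transition probability $\widetilde P$, and $\widetilde P$ is geometrically ergodic with stationary law $\pi_2$. Here the initial laws of $X_0$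 and $W_0$ are arbitrary. 2. Let $W_0$ have law $\pi_2$ (and $X_0$ an arbitrary law). If $\{W_t\}$ is strongly mixing, then $\{\widetilde W_k\}$ is strongly mixing, and it mixes at least as fast: $\alpha_\ell(\widetilde W)\le\alpha_\ell(W)$ for all $\ell\ge0$. 3. Let $W_0$ have law $\pi_2$ (and $X_0$ an arbitrary law). For every integer $p\ge0$, $$\sum_{\ell=1}^\infty \ell^p\alpha_\ell(W)<\infty\quad\Longrightarrow\quad \mathbb E\,\mathcal T^{\,p+1}<\infty .$$ -/

import Mathlib

open MeasureTheory ProbabilityTheory Filter Topology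
open scoped ENNReal NNReal

noncomputable section

/-! ### Markov chains on a general measurable state space -/

/-- The one-step kernel `P`, read as a kernel that looks at a whole past `(z_0, …, z_n)` and moves
from its last entry `z_n`. -/
def historyKernel {E : Type*} [MeasurableSpace E] (P : Kernel E E) (n : ℕ) :
    Kernel ((i : Finset.Iic n) → (fun _ : ℕ => E) i) E :=
  P.comap (fun z => z ⟨n, Finset.mem_Iic.mpr le_rfl⟩) (measurable_pi_apply _)

instance {E : Type*} [MeasurableSpace E] (P : Kernel E E) [IsMarkovKernel P] (n : ℕ) :
    IsMarkovKernel (historyKernel P n) := by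
  unfold historyKernel; infer_instance

/-- `Z` is a (time-homogeneous) Markov chain with transition probability `P` under `μ`:
given `Z_0, …, Z_n`, the conditional law of `Z_{n+1}` is `P(Z_n, ·)`. The initial law is free. -/
structure IsMarkovChain {Ω E : Type*} [MeasurableSpace Ω] [MeasurableSpace E]
    (μ : Measure Ω) (Z : ℕ → Ω → E) (P : Kernel E E) : Prop where
  measurable : ∀ n, Measurable (Z n)
  markov : ∀ n, HasCondDistrib (Z (n + 1)) (fun ω (i : Finset.Iic n) => Z i ω)
    (historyKernel P n) μ

/-- The law, on the space of trajectories, of the Markov chain with transition probability `P`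
started at `x`. -/
def pathLaw {E : Type*} [MeasurableSpace E] (P : Kernel E E) [IsMarkovKernel P] (x : E) :
    Measure (ℕ → E) :=
  Kernel.traj (X := fun _ => E) (historyKernel P) 0 (fun _ => x)

/-- `φ`-irreducibility, with a nontrivial irreducibility measure `φ`. -/
def IsPhiIrreducible {E : Type*} [MeasurableSpace E] (P : Kernel E E) (φ : Measure E) : Prop :=
  φ ≠ 0 ∧ Kernel.IsIrreducible φ P

/-- Harris recurrence: the chain is `φ`-irreducible and, from every starting point, almost surely
visits every `φ`-positive set infinitely often. -/
def IsHarrisRecurrent {E : Type*} [MeasurableSpace E] (P : Kernel E E) [IsMarkovKernel P]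
    (φ : Measure E) : Prop :=
  IsPhiIrreducible P φ ∧
    ∀ A : Set E, MeasurableSet A → 0 < φ A →
      ∀ x, ∀ᵐ z ∂(pathLaw P x), ∃ᶠ n in atTop, z n ∈ A

/-- Total variation distance `sup_A |κ(A) - η(A)|` (used for finite measures only). -/
def tvDist {E : Type*} [MeasurableSpace E] (κ η : Measure E) : ℝ≥0∞ :=
  ⨆ (A : Set E) (_ : MeasurableSet A), ENNReal.ofReal |κ.real A - η.real A|

/-- Ergodicity with stationary law `π`: `π` is invariant, and `P^n(x, ·) → π` in total variation
from every `x`. -/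
def IsErgodicKernel {E : Type*} [MeasurableSpace E] (P : Kernel E E) (π : Measure E) : Prop :=
  Kernel.Invariant P π ∧ ∀ x, Tendsto (fun n : ℕ => tvDist ((P ^ n) x) π) atTop (𝓝 0)

/-- Geometric ergodicity: ergodicity, with `‖P^n(x, ·) - π‖ ≤ M(x) ρ^n` for all `x` and `n`, for
some constant `ρ ∈ (0, 1)` and some nonnegative `π`-integrable function `M`. -/
def IsGeometricallyErgodic {E : Type*} [MeasurableSpace E] (P : Kernel E E) (π : Measure E) :
    Prop :=
  IsErgodicKernel P π ∧
    ∃ (ρ : ℝ≥0) (M : E → ℝ≥0∞), 0 < ρ ∧ ρ < 1 ∧ Measurable M ∧ ∫⁻ x, M x ∂π < ∞ ∧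
      ∀ x (n : ℕ), tvDist ((P ^ n) x) π ≤ M x * (ρ : ℝ≥0∞) ^ n

/-! ### Strong mixing -/

/-- The `ℓ`-th strong (α-)mixing coefficient of the process `Z` under `μ`: the supremum over `k`,
over `A ∈ σ(Z_i, i ≤ k)` and over `B ∈ σ(Z_i, i ≥ k + ℓ)` of `|μ(A ∩ B) - μ(A) μ(B)|`. -/
def mixingCoeff {Ω E : Type*} [MeasurableSpace Ω] [mE : MeasurableSpace E]
    (μ : Measure Ω) (Z : ℕ → Ω → E) (l : ℕ) : ℝ :=
  sSup {r : ℝ | ∃ (k : ℕ) (A B : Set Ω),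
    MeasurableSet[⨆ i : {i : ℕ // i ≤ k}, mE.comap (Z i)] A ∧
    MeasurableSet[⨆ i : {i : ℕ // k + l ≤ i}, mE.comap (Z i)] B ∧
    r = |μ.real (A ∩ B) - μ.real A * μ.real B|}

/-- `Z` is strongly mixing under `μ`: its mixing coefficients tend to `0`. -/
def IsStronglyMixing {Ω E : Type*} [MeasurableSpace Ω] [MeasurableSpace E]
    (μ : Measure Ω) (Z : ℕ → Ω → E) : Prop :=
  Tendsto (mixingCoeff μ Z) atTop (𝓝 0)

/-! ### Atoms (minorization) and the split chain -/

/-- A minorization `P ≥ s ⊗ ν` with `s ≥ 0` measurable and `ν` a probability measure. -/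
structure Atom {E : Type*} [MeasurableSpace E] (P : Kernel E E) where
  s : E → ℝ≥0∞
  ν : Measure E
  measurable_s : Measurable s
  isProb : IsProbabilityMeasure ν
  minor : ∀ x (A : Set E), MeasurableSet A → s x * ν A ≤ P x A

namespace Atom

variable {E : Type*} [MeasurableSpace E] {P : Kernel E E}

theorem smul_le (a : Atom P) (x : E) : a.s x • a.ν ≤ P x :=
  Measure.le_iff.2 fun A hA => by simpa using a.minor x A hA

variable [IsMarkovKernel P]

theorem s_le_one (a : Atom P) (x : E) : a.s x ≤ 1 := by
  have := a.isProb
  simpa using a.minor x Set.univ MeasurableSet.univ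

theorem isFinite_smul (a : Atom P) (x : E) : IsFiniteMeasure (a.s x • a.ν) :=
  isFiniteMeasure_of_le (P x) (a.smul_le x)

theorem sub_apply (a : Atom P) (x : E) {A : Set E} (hA : MeasurableSet A) :
    (P x - a.s x • a.ν) A = P x A - a.s x * a.ν A := by
  have := a.isFinite_smul x
  simp [Measure.sub_apply hA (a.smul_le x)]

/-- The taboo kernel `H = P - s ⊗ ν`. -/
def taboo (a : Atom P) : Kernel E E where
  toFun x := P x - a.s x • a.ν
  measurable' := by
    refine Measure.measurable_of_measurable_coe _ fun A hA => ?_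
    simp_rw [fun x => a.sub_apply x hA]
    exact (P.measurable_coe hA).sub (a.measurable_s.mul_const _)

/-- The residual kernel `Q`: `Q(x, ·) = (P(x, ·) - s(x) ν) / (1 - s(x))` where `s(x) < 1`, and
`Q(x, ·) = δ_x` where `s(x) = 1`; so `P(x, ·) = (1 - s(x)) Q(x, ·) + s(x) ν`. -/
def residual (a : Atom P) : Kernel E E where
  toFun x := open Classical in
    if a.s x < 1 then (1 - a.s x)⁻¹ • (P x - a.s x • a.ν) else Measure.dirac x
  measurable' := by
    classical
    refine Measurable.ite (measurableSet_lt a.measurable_s measurable_const) ?_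
      Measure.measurable_dirac
    refine Measure.measurable_of_measurable_coe _ fun A hA => ?_
    simp_rw [Measure.smul_apply, fun x => a.sub_apply x hA, smul_eq_mul]
    exact (measurable_const.sub a.measurable_s).inv.mul
      ((P.measurable_coe hA).sub (a.measurable_s.mul_const _))

/-- The coin toss: at `x`, the value `1` (`true`) has probability `s(x)`. -/
def coin (a : Atom P) : Kernel E Bool where
  toFun x := a.s x • Measure.dirac true + (1 - a.s x) • Measure.dirac false
  measurable' := by
    refine Measure.measurable_of_measurable_coe _ fun A hA => ?_
    simp only [Measure.add_apply, Measure.smul_apply, smul_eq_mul]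
    exact (a.measurable_s.mul_const _).add
      ((measurable_const.sub a.measurable_s).mul_const _)

/-- The move of the first coordinate of the split chain: from `(x, 1)` the next position has
law `ν` (regeneration), from `(x, 0)` it has law `Q(x, ·)`. -/
def move (a : Atom P) : Kernel (E × Bool) E where
  toFun z := open Classical in if z.2 = true then a.ν else a.residual z.1
  measurable' := by
    classical
    exact Measurable.ite (measurable_snd (measurableSet_singleton true)) measurable_const
      (a.residual.measurable.comp measurable_fst)

instance (a : Atom P) : IsMarkovKernel a.coin := ⟨fun x => ⟨by
  simp [coin, add_tsub_cancel_of_le (a.s_le_one x)]⟩⟩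

instance (a : Atom P) : IsMarkovKernel a.residual := ⟨fun x => ⟨by
  have := a.isProb
  by_cases h : a.s x < 1
  · have h0 : 1 - a.s x ≠ 0 := (tsub_pos_of_lt h).ne'
    have h1 : 1 - a.s x ≠ ∞ := (tsub_le_self.trans_lt ENNReal.one_lt_top).ne
    simp [residual, h, a.sub_apply x MeasurableSet.univ, ENNReal.inv_mul_cancel h0 h1]
  · simp [residual, h]⟩⟩

instance (a : Atom P) : IsMarkovKernel a.move := ⟨fun z => by
  have := a.isProb
  by_cases h : z.2 = true
  · simpa [move, h] using a.isProb
  · simp only [move, h, Kernel.coe_mk]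
    simp only [Bool.false_eq_true, if_false]
    infer_instance⟩

/-- The transition probability of the split chain: first the position moves, and then a new coin
is tossed at the new position. -/
def splitKernel (a : Atom P) : Kernel (E × Bool) (E × Bool) :=
  a.move ⊗ₖ (Kernel.prodMkLeft (E × Bool) a.coin)

/-- `b ℓ = ν H^ℓ s`: the probability that a split chain whose position is drawn from `ν` at time
`0` regenerates for the first time at time `ℓ`. -/
def regenProb (a : Atom P) (l : ℕ) : ℝ≥0∞ :=
  ∫⁻ x, ∫⁻ y, a.s y ∂((a.taboo ^ l) x) ∂a.ν

end Atom

/-- `{(X_t, Y_t)}` is the split chain of the Markov chain with transition probability `P` for the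
atom `a = (s, ν)`; the law of `X_0` is arbitrary, and given `X_0` the value of `Y_0` is `1` with
probability `s(X_0)`. -/
structure IsSplitChain {Ω E : Type*} [MeasurableSpace Ω] [MeasurableSpace E] {P : Kernel E E}
    [IsMarkovKernel P] (a : Atom P) (μ : Measure Ω) (X : ℕ → Ω → E) (Y : ℕ → Ω → Bool) :
    Prop where
  chain : IsMarkovChain μ (fun t ω => (X t ω, Y t ω)) a.splitKernel
  init : HasCondDistrib (Y 0) (X 0) a.coin μ

/-! ### The embedded process -/

/-- The successive regeneration times `τ_0 < τ_1 < …`: `τ_k` is the `k`-th time `t ≥ 0` (counting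
from `k = 0`) with `Y_t = 1`. -/
def regTime {Ω : Type*} (Y : ℕ → Ω → Bool) (k : ℕ) (ω : Ω) : ℕ :=
  Nat.nth (fun t => Y t ω = true) k

/-- The process `Z` observed at the regeneration times given by `Y`: `k ↦ Z_{τ_k}`. -/
def embedded {Ω F : Type*} (Y : ℕ → Ω → Bool) (Z : ℕ → Ω → F) (k : ℕ) (ω : Ω) : F :=
  Z (regTime Y k ω) ω

/-- `𝒯 = inf {j ≥ 0 : Y'_{τ_j} = 1}`, where `τ_j` are the regeneration times given by `Y`;
it is `∞` if there is no such `j`. -/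
def firstJointRegen {Ω : Type*} (Y Y' : ℕ → Ω → Bool) (ω : Ω) : ℝ≥0∞ :=
  ⨅ (j : ℕ) (_ : embedded Y Y' j ω = true), (j : ℝ≥0∞)

/-- `Φ_{ν₁} = ∑_ℓ {ν₁ (P₁ - s₁ ⊗ ν₁)^ℓ s₁} P₂^ℓ`. -/
def mixtureKernel {E F : Type*} [MeasurableSpace E] [MeasurableSpace F] {P₁ : Kernel E E}
    [IsMarkovKernel P₁] (a₁ : Atom P₁) (P₂ : Kernel F F) : Kernel F F where
  toFun w := Measure.sum fun l : ℕ => a₁.regenProb l • (P₂ ^ l) w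
  measurable' := by
    refine Measure.measurable_of_measurable_coe _ fun A hA => ?_
    simp_rw [Measure.sum_apply _ hA, Measure.smul_apply, smul_eq_mul]
    exact Measurable.tsum fun l => ((P₂ ^ l).measurable_coe hA).const_mul _

/-- The transition probability `P̃ = P₂ Φ_{ν₁}` of the embedded chain (first a step of `P₂`, then
`Φ_{ν₁}`). -/
def embeddedKernel {E F : Type*} [MeasurableSpace E] [MeasurableSpace F] {P₁ : Kernel E E}
    [IsMarkovKernel P₁] (a₁ : Atom P₁) (P₂ : Kernel F F) : Kernel F F :=
  mixtureKernel a₁ P₂ ∘ₖ P₂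

end

/-! Write τ for the regeneration times of the first chain. They are independent of the second split
chain, so the embedded process is that chain read along an independent random sequence of times.
Harris recurrence and Lévy's conditional Borel–Cantelli lemma make τ infinite in number
(`IsSplitChain.ae_frequently_true`). Since the first split chain restarts from ν₁ after each coin 1,
the gaps of τ are i.i.d. with law `Atom.gapLaw` (`IsSplitChain.step_regGap`,
`IsSplitChain.iIndepFun_regGap`). Every statement is proved by freezing τ, using the second chain at
fixed times, and averaging over τ.

Ergodicity. The embedded kernel is a mixture of the powers P₂^d, d ≥ 1, so its n-th power is a
mixture of powers P₂^j with j ≥ n. Total variation distance to π₂ is convex, so any bound valid for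
all j ≥ n passes to the mixture (`tvDist_embeddedKernel_pow_le`); the same ρ and M serve.

Mixing. With τ frozen, the covariance of an event up to index k and one from index k + ℓ on is at
most α_ℓ, because τ_{k+ℓ} ≥ τ_k + ℓ. What remains is the covariance of the two conditional
probabilities. By stationarity of the observed process these depend only on the gaps before k and
only on the gaps from k + ℓ on, hence are independent (`IsSplitChain.mixingCoeff_embedded_le`).

Moments. The same bound applies to the coins of the second chain read along τ, and those coins mix
as fast as W up to one time unit (`IsSplitChain.mixingCoeff_coin_le`). Let v(m) be the largest
probability of m consecutive zeros. Dropping the middle third of a run gives v(3m) ≤ v(m)² + α_m. As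
v(1) < 1, this forces v → 0, after which the quadratic term is absorbed and ∑ n^p v(n) inherits
convergence from ∑ n^p α_n (`summable_pow_mul_of_triple_le`). That sum controls the moment of order
p + 1. -/

/-! ### Conditional laws relative to a sub-σ-algebra -/

section Step

variable {Ω E F G : Type*} {m m' : MeasurableSpace Ω} [mΩ : MeasurableSpace Ω]
  [MeasurableSpace E] [MeasurableSpace F] [MeasurableSpace G] {μ : Measure Ω} {U : Ω → E}
  {V : Ω → F} {W : Ω → G}

/-- Given `m`, the conditional law of `V` is `κ (U, ·)`. -/
def IsStep (μ : Measure Ω) (m : MeasurableSpace Ω) (U : Ω → E) (V : Ω → F) (κ : Kernel E F) :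
    Prop :=
  ∀ A, MeasurableSet[m] A →
    @Measure.map _ _ mΩ _ V (μ.restrict A) = κ ∘ₘ @Measure.map _ _ mΩ _ U (μ.restrict A)

theorem IsStep.setLIntegral {κ : Kernel E F} (h : IsStep μ m U V κ) (hU : Measurable U)
    (hV : Measurable V) {A : Set Ω} (hA : MeasurableSet[m] A) {f : F → ℝ≥0∞} (hf : Measurable f) :
    ∫⁻ ω in A, f (V ω) ∂μ = ∫⁻ ω in A, ∫⁻ y, f y ∂κ (U ω) ∂μ := by
  rw [← lintegral_map hf hV, h A hA, Measure.lintegral_bind κ.aemeasurable hf.aemeasurable,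
    lintegral_map hf.lintegral_kernel hU]

theorem IsStep.measure_inter {κ : Kernel E F} (h : IsStep μ m U V κ) (hU : Measurable U)
    (hV : Measurable V) {A : Set Ω} (hA : MeasurableSet[m] A) {B : Set F}
    (hB : MeasurableSet B) : μ (A ∩ V ⁻¹' B) = ∫⁻ ω in A, κ (U ω) B ∂μ := by
  have := h.setLIntegral hU hV hA (f := B.indicator 1) (measurable_one.indicator hB)
  simp only [lintegral_indicator_one hB] at this
  rw [← this, show (fun ω => B.indicator (1 : F → ℝ≥0∞) (V ω)) = (V ⁻¹' B).indicator 1 from rfl,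
    lintegral_indicator_one (hV hB), Measure.restrict_apply (hV hB), Set.inter_comm]

theorem IsStep.of_measure_inter {κ : Kernel E F} (hU : Measurable U) (hV : Measurable V)
    (h : ∀ A, MeasurableSet[m] A → ∀ B, MeasurableSet B →
      μ (A ∩ V ⁻¹' B) = ∫⁻ ω in A, κ (U ω) B ∂μ) : IsStep μ m U V κ := by
  intro A hA
  ext B hB
  rw [Measure.map_apply hV hB, Measure.restrict_apply (hV hB), Set.inter_comm, h A hA B hB,
    Measure.bind_apply hB κ.aemeasurable, lintegral_map (κ.measurable_coe hB) hU]

/-- Phrased through restricted measures, chaining conditional laws is just associativity of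
composition; no conditional expectation or regular version is involved. -/
theorem IsStep.trans {κ : Kernel E F} {η : Kernel F G} (h : IsStep μ m U V κ)
    (h' : IsStep μ m' V W η) (hm : m ≤ m') : IsStep μ m U W (η ∘ₖ κ) := by
  intro A hA
  rw [h' A (hm A hA), h A hA, Measure.comp_assoc]

theorem IsStep.map {κ : Kernel E F} (h : IsStep μ m U V κ) (hV : Measurable V) {f : F → G}
    (hf : Measurable f) : IsStep μ m U (fun ω => f (V ω)) (κ.map f) := by
  intro A hA
  rw [← Measure.map_comp _ _ hf, ← h A hA, Measure.map_map hf hV]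
  rfl

theorem IsStep.map_eq {κ : Kernel E F} (h : IsStep μ m U V κ) : μ.map V = κ ∘ₘ μ.map U := by
  simpa using h Set.univ MeasurableSet.univ

theorem ProbabilityTheory.HasCondDistrib.isStep [IsFiniteMeasure μ] {κ : Kernel E F}
    [IsMarkovKernel κ] {H : Ω → G} {φ : G → E} (hφ : Measurable φ) (hH : Measurable H)
    (hV : Measurable V)
    (h : HasCondDistrib V H (κ.comap φ hφ) μ) :
    IsStep μ (MeasurableSpace.comap H inferInstance) (fun ω => φ (H ω)) V κ := by
  refine IsStep.of_measure_inter (hφ.comp hH) hV ?_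
  rintro _ ⟨S, hS, rfl⟩ B hB
  have h1 : μ (H ⁻¹' S ∩ V ⁻¹' B) = μ.map (fun ω => (H ω, V ω)) (S ×ˢ B) := by
    rw [Measure.map_apply (hH.prodMk hV) (hS.prod hB)]; rfl
  rw [h1, h.map_eq, Measure.compProd_apply_prod hS hB,
    setLIntegral_map hS ((κ.comap φ hφ).measurable_coe hB) hH]
  rfl

theorem IsStep.hasCondDistrib [IsFiniteMeasure μ] {κ : Kernel E F}
    [IsMarkovKernel κ] {H : Ω → G} {φ : G → E} (hφ : Measurable φ) (hH : Measurable H)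
    (hV : Measurable V)
    (h : IsStep μ (MeasurableSpace.comap H inferInstance) (fun ω => φ (H ω)) V κ) :
    HasCondDistrib V H (κ.comap φ hφ) μ := by
  refine ⟨(hH.prodMk hV).aemeasurable, ?_⟩
  refine Measure.ext_prod fun {S B} hS hB => ?_
  rw [Measure.map_apply (hH.prodMk hV) (hS.prod hB), Measure.compProd_apply_prod hS hB,
    setLIntegral_map hS ((κ.comap φ hφ).measurable_coe hB) hH]
  exact h.measure_inter (hφ.comp hH) hV ⟨S, hS, rfl⟩ hB

end Step

/-! ### Markov chains relative to a filtration -/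

section Markov

variable {Ω E : Type*} [mE : MeasurableSpace E]

/-- The σ-algebra generated by `Z_0, …, Z_n`. -/
@[reducible]
def past (Z : ℕ → Ω → E) (n : ℕ) : MeasurableSpace Ω :=
  MeasurableSpace.comap (fun ω (i : Finset.Iic n) => Z i ω) MeasurableSpace.pi

theorem measurable_past (Z : ℕ → Ω → E) {i n : ℕ} (h : i ≤ n) : Measurable[past Z n] (Z i) :=
  (measurable_pi_apply (X := fun _ : Finset.Iic n => E) ⟨i, Finset.mem_Iic.2 h⟩).comp
    (comap_measurable _)

theorem past_le {Z : ℕ → Ω → E} {m : MeasurableSpace Ω} {n : ℕ}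
    (h : ∀ i ≤ n, Measurable[m] (Z i)) : past Z n ≤ m := by
  refine Measurable.comap_le (@measurable_pi_lambda Ω _ _ m _ _ fun i => h i ?_)
  exact Finset.mem_Iic.1 i.2

theorem past_mono (Z : ℕ → Ω → E) : Monotone (past Z) :=
  fun _ _ h => past_le fun _ hi => measurable_past Z (hi.trans h)

variable [mΩ : MeasurableSpace Ω] {μ : Measure Ω}

/-- `Z` is a Markov chain with transition probability `P` relative to the filtration `ℱ`. -/
structure IsMarkovWrt (μ : Measure Ω) (ℱ : ℕ → MeasurableSpace Ω) (Z : ℕ → Ω → E)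
    (P : Kernel E E) : Prop where
  mono : Monotone ℱ
  le : ∀ n, ℱ n ≤ mΩ
  adapted : ∀ n, Measurable[ℱ n] (Z n)
  step : ∀ n, IsStep μ (ℱ n) (Z n) (Z (n + 1)) P

theorem IsMarkovWrt.measurable {ℱ : ℕ → MeasurableSpace Ω} {Z : ℕ → Ω → E} {P : Kernel E E}
    (h : IsMarkovWrt μ ℱ Z P) (n : ℕ) : Measurable (Z n) := (h.adapted n).mono (h.le n) le_rfl

theorem IsMarkovChain.isMarkovWrt [IsFiniteMeasure μ] {Z : ℕ → Ω → E} {P : Kernel E E}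
    [IsMarkovKernel P] (h : IsMarkovChain μ Z P) : IsMarkovWrt μ (past Z) Z P where
  mono := past_mono Z
  le _ := past_le fun i _ => h.measurable i
  adapted _ := measurable_past Z le_rfl
  step n := HasCondDistrib.isStep (κ := P) (H := fun ω (i : Finset.Iic n) => Z i ω)
    (φ := fun z => z ⟨n, Finset.mem_Iic.mpr le_rfl⟩) (measurable_pi_apply _)
    (measurable_pi_lambda _ fun i => h.measurable i) (h.measurable _) (h.markov n)

theorem IsMarkovChain.of_isStep [IsFiniteMeasure μ] {Z : ℕ → Ω → E} {P : Kernel E E}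
    [IsMarkovKernel P] (hZ : ∀ n, Measurable (Z n))
    (h : ∀ n, IsStep μ (past Z n) (Z n) (Z (n + 1)) P) : IsMarkovChain μ Z P where
  measurable := hZ
  markov n := IsStep.hasCondDistrib (κ := P) (H := fun ω (i : Finset.Iic n) => Z i ω)
    (φ := fun z => z ⟨n, Finset.mem_Iic.mpr le_rfl⟩) (measurable_pi_apply _)
    (measurable_pi_lambda _ fun i => hZ i) (hZ _) (h n)

theorem IsMarkovWrt.step_add {ℱ : ℕ → MeasurableSpace Ω} {Z : ℕ → Ω → E} {P : Kernel E E}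
    (h : IsMarkovWrt μ ℱ Z P) (k n : ℕ) : IsStep μ (ℱ k) (Z k) (Z (k + n)) (P ^ n) := by
  induction n with
  | zero =>
    intro A _
    rw [pow_zero]
    exact Measure.id_comp.symm
  | succ n ih => rw [pow_succ']; exact ih.trans (h.step (k + n)) (h.mono (Nat.le_add_right _ _))

/-- The set of the paths with `z_i ∈ S_i` for all `i < n`. -/
def pathBox (S : ℕ → Set E) (n : ℕ) : Set (ℕ → E) := {z | ∀ i < n, z i ∈ S i}

theorem measurableSet_pathBox {S : ℕ → Set E} (hS : ∀ i, MeasurableSet (S i)) (n : ℕ) :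
    MeasurableSet (pathBox S n) := by
  have : pathBox S n = ⋂ i ∈ Finset.range n, (fun z : ℕ → E => z i) ⁻¹' S i := by
    ext; simp [pathBox]
  rw [this]
  exact Finset.measurableSet_biInter _ fun i _ => measurable_pi_apply i (hS i)

/-- Boxes form a π-system generating the product σ-algebra: shorter boxes are padded with
`Set.univ`, and the box of length 0 compares the total masses. -/
theorem ext_of_pathBox {ρ ρ' : Measure (ℕ → E)} [IsFiniteMeasure ρ]
    (h : ∀ S : ℕ → Set E, (∀ i, MeasurableSet (S i)) → ∀ n,
      ρ (pathBox S n) = ρ' (pathBox S n)) : ρ = ρ' := by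
  refine ext_of_generate_finite
    {B | ∃ S : ℕ → Set E, (∀ i, MeasurableSet (S i)) ∧ ∃ n, pathBox S n = B} ?_ ?_ ?_ ?_
  · refine le_antisymm ?_ ?_
    · refine iSup_le fun i => ?_
      rintro _ ⟨T, hT, rfl⟩
      refine MeasurableSpace.measurableSet_generateFrom
        ⟨fun j => if j = i then T else Set.univ, fun j => ?_, i + 1, ?_⟩
      · dsimp only; split_ifs; exacts [hT, .univ]
      · ext z
        constructor
        · intro hz; simpa using hz i (Nat.lt_succ_self i)
        · intro hz j _
          by_cases hj : j = i
          · subst hj; simpa using hz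
          · simp [hj]
    · refine MeasurableSpace.generateFrom_le ?_
      rintro _ ⟨S, hS, n, rfl⟩
      exact measurableSet_pathBox hS n
  · rintro _ ⟨S, hS, n, rfl⟩ _ ⟨T, hT, k, rfl⟩ -
    refine ⟨fun i => (if i < n then S i else Set.univ) ∩ (if i < k then T i else Set.univ),
      fun i => ?_, max n k, ?_⟩
    · refine MeasurableSet.inter ?_ ?_ <;> split_ifs
      exacts [hS i, .univ, hT i, .univ]
    · ext z
      simp only [pathBox, Set.mem_ofPred_eq, Set.mem_inter_iff]
      constructor
      · intro hz
        exact ⟨fun i hi => by simpa [hi] using (hz i (lt_max_of_lt_left hi)).1,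
          fun i hi => by simpa [hi] using (hz i (lt_max_of_lt_right hi)).2⟩
      · rintro ⟨h1, h2⟩ i -
        constructor <;> split_ifs <;> simp_all
  · rintro _ ⟨S, hS, n, rfl⟩
    exact h S hS n
  · simpa [pathBox] using h (fun _ => Set.univ) (fun _ => .univ) 0

/-- The probability that a Markov chain started at `x` satisfies `Z_i ∈ S_i` for all `i < n`. -/
noncomputable def boxProb (P : Kernel E E) : ℕ → (ℕ → Set E) → E → ℝ≥0∞
  | 0, _ => 1
  | n + 1, S => (S 0).indicator fun x => ∫⁻ y, boxProb P n (fun i => S (i + 1)) y ∂P x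

theorem measurable_boxProb (P : Kernel E E) (n : ℕ) {S : ℕ → Set E}
    (hS : ∀ i, MeasurableSet (S i)) : Measurable (boxProb P n S) := by
  induction n generalizing S with
  | zero => exact measurable_one
  | succ n ih => exact (ih fun i => hS (i + 1)).lintegral_kernel.indicator (hS 0)

/-- Induction on the length of the box: the first constraint is absorbed into the past event, which
stays in `ℱ k`, and one step of the kernel moves the problem to time k + 1. -/
theorem IsMarkovWrt.measure_inter_box {ℱ : ℕ → MeasurableSpace Ω} {Z : ℕ → Ω → E}
    {P : Kernel E E} (h : IsMarkovWrt μ ℱ Z P) (n k : ℕ) {A : Set Ω} (hA : MeasurableSet[ℱ k] A)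
    {S : ℕ → Set E} (hS : ∀ i, MeasurableSet (S i)) :
    μ (A ∩ (fun ω i => Z (k + i) ω) ⁻¹' pathBox S n) = ∫⁻ ω in A, boxProb P n S (Z k ω) ∂μ := by
  induction n generalizing k A S with
  | zero => simp [pathBox, boxProb]
  | succ n ih =>
    have hA' : MeasurableSet[ℱ k] (A ∩ Z k ⁻¹' S 0) := hA.inter (h.adapted k (hS 0))
    have e : A ∩ (fun ω i => Z (k + i) ω) ⁻¹' pathBox S (n + 1) =
        (A ∩ Z k ⁻¹' S 0) ∩ (fun ω i => Z (k + 1 + i) ω) ⁻¹' pathBox (fun i => S (i + 1)) n := by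
      ext ω
      simp only [pathBox, Set.mem_inter_iff, Set.mem_preimage, Set.mem_ofPred_eq, and_assoc]
      refine and_congr_right fun _ => ?_
      rw [Nat.forall_lt_succ_left]
      simp only [add_zero, Nat.add_assoc, Nat.add_comm 1]
    rw [e, ih (k + 1) (h.mono (Nat.le_succ k) _ hA') (fun i => hS (i + 1)),
      (h.step k).setLIntegral (h.measurable _) (h.measurable _) hA'
        (measurable_boxProb P n fun i => hS (i + 1)), Set.inter_comm,
      ← setLIntegral_indicator (h.measurable k (hS 0))]
    rfl

theorem IsMarkovWrt.map_eq_of_invariant {ℱ : ℕ → MeasurableSpace Ω}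
    {Z : ℕ → Ω → E} {P : Kernel E E} (h : IsMarkovWrt μ ℱ Z P) (hπ : Kernel.Invariant P (μ.map (Z 0))) (k : ℕ) :
    μ.map (Z k) = μ.map (Z 0) := by
  induction k with
  | zero => rfl
  | succ k ih => rw [(h.step k).map_eq, ih]; exact hπ

/-! ### Laws of whole trajectories and stationarity. -/

variable (P : Kernel E E) [IsMarkovKernel P]

theorem pathLaw_eq_trajMeasure (x : E) :
    pathLaw P x = Kernel.trajMeasure (X := fun _ => E) (Measure.dirac x) (historyKernel P) := by
  rw [Kernel.trajMeasure, Measure.map_dirac' (MeasurableEquiv.measurable _),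
    Measure.dirac_bind (Kernel.measurable _)]
  rfl

/-- The law of the trajectory of a Markov chain, as a kernel. -/
noncomputable def pathKernel : Kernel E (ℕ → E) :=
  (Kernel.traj (X := fun _ => E) (historyKernel P) 0).comap (fun x _ => x)
    (measurable_pi_lambda _ fun _ => measurable_id)

theorem pathKernel_apply (x : E) : pathKernel P x = pathLaw P x := rfl

instance : IsMarkovKernel (pathKernel P) := by unfold pathKernel; infer_instance

instance (x : E) : IsProbabilityMeasure (pathLaw P x) := by
  rw [← pathKernel_apply]; infer_instance

theorem pathLaw_isMarkovChain (x : E) : IsMarkovChain (pathLaw P x) (fun n z => z n) P where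
  measurable n := measurable_pi_apply n
  markov n := by
    refine ⟨by fun_prop, ?_⟩
    rw [pathLaw_eq_trajMeasure]
    exact Kernel.map_frestrictLe_trajMeasure_compProd_eq_map_trajMeasure.symm

theorem pathLaw_map_zero (x : E) : (pathLaw P x).map (fun z => z 0) = Measure.dirac x := by
  have h := Kernel.traj_map_frestrictLe_apply (X := fun _ => E) (κ := historyKernel P) 0 0
    (fun _ => x)
  rw [Kernel.partialTraj_self, Kernel.id_apply] at h
  have h2 := congrArg (Measure.map fun z : (i : Finset.Iic 0) → (fun _ : ℕ => E) i =>
    z ⟨0, by simp⟩) h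
  rw [Measure.map_map (by fun_prop) (by fun_prop), Measure.map_dirac' (by fun_prop)] at h2
  exact h2

theorem pathLaw_box (x : E) (n : ℕ) {S : ℕ → Set E} (hS : ∀ i, MeasurableSet (S i)) :
    pathLaw P x (pathBox S n) = boxProb P n S x := by
  have h := (pathLaw_isMarkovChain P x).isMarkovWrt.measure_inter_box n 0 MeasurableSet.univ hS
  simp only [zero_add, Set.univ_inter, Measure.restrict_univ] at h
  rw [show (fun (ω : ℕ → E) i => ω i) = id from rfl, Set.preimage_id] at h
  rw [h, ← lintegral_map (measurable_boxProb P n hS) (measurable_pi_apply 0), pathLaw_map_zero,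
    lintegral_dirac' _ (measurable_boxProb P n hS)]

variable {P} in
theorem IsMarkovWrt.shift [IsFiniteMeasure μ] {ℱ : ℕ → MeasurableSpace Ω} {Z : ℕ → Ω → E}
    (h : IsMarkovWrt μ ℱ Z P) (k : ℕ) :
    IsStep μ (ℱ k) (Z k) (fun ω i => Z (k + i) ω) (pathKernel P) := by
  intro A hA
  have hm : Measurable fun ω i => Z (k + i) ω := measurable_pi_lambda _ fun i => h.measurable _
  refine ext_of_pathBox fun S hS n => ?_
  rw [Measure.map_apply hm (measurableSet_pathBox hS n),
    Measure.restrict_apply (hm (measurableSet_pathBox hS n)), Set.inter_comm,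
    h.measure_inter_box n k hA hS,
    Measure.bind_apply (measurableSet_pathBox hS n) (pathKernel P).aemeasurable,
    lintegral_map ((pathKernel P).measurable_coe (measurableSet_pathBox hS n)) (h.measurable k)]
  simp_rw [pathKernel_apply, pathLaw_box P _ n hS]

/-- `Z` is stationary: shifting the time does not change its law. -/
def HasStationaryLaw (μ : Measure Ω) (Z : ℕ → Ω → E) : Prop :=
  ∀ k, μ.map (fun ω i => Z (k + i) ω) = μ.map fun ω i => Z i ω

variable {P} in
theorem IsMarkovWrt.hasStationaryLaw [IsFiniteMeasure μ] {ℱ : ℕ → MeasurableSpace Ω}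
    {Z : ℕ → Ω → E} (h : IsMarkovWrt μ ℱ Z P) (hπ : Kernel.Invariant P (μ.map (Z 0))) :
    HasStationaryLaw μ Z := by
  intro k
  have h0 := (h.shift 0).map_eq
  simp only [zero_add] at h0
  rw [(h.shift k).map_eq, h.map_eq_of_invariant hπ k, h0]

theorem HasStationaryLaw.comp {F : Type*} [MeasurableSpace F] {Z : ℕ → Ω → E} (h : HasStationaryLaw μ Z)
    (hZ : ∀ n, Measurable (Z n)) {f : E → F} (hf : Measurable f) :
    HasStationaryLaw μ (fun n ω => f (Z n ω)) := by
  intro k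
  have hf' : Measurable fun (z : ℕ → E) i => f (z i) :=
    measurable_pi_lambda _ fun i => hf.comp (measurable_pi_apply i)
  have := congrArg (Measure.map fun (z : ℕ → E) i => f (z i)) (h k)
  rwa [Measure.map_map hf' (measurable_pi_lambda _ fun i => hZ _),
    Measure.map_map hf' (measurable_pi_lambda _ fun i => hZ _)] at this

end Markov

/-! ### The split chain -/

/-- As `U` is `m`-measurable, a constraint on `U` can be absorbed into the conditioning event. -/
theorem IsStep.prodMk {Ω E F : Type*} {m : MeasurableSpace Ω} [mΩ : MeasurableSpace Ω]
    [MeasurableSpace E] [MeasurableSpace F] {μ : Measure Ω} [IsFiniteMeasure μ] {U : Ω → E}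
    {V : Ω → F} {κ : Kernel E F} [IsMarkovKernel κ] (h : IsStep μ m U V κ)
    (hm : m ≤ mΩ) (hU : Measurable[m] U) (hV : Measurable V) :
    IsStep μ m U (fun ω => (U ω, V ω)) (Kernel.id ×ₖ κ) := by
  have hU' : Measurable U := hU.mono hm le_rfl
  intro A hA
  rw [← Measure.compProd_eq_comp_prod]
  refine Measure.ext_prod fun {S B} hS hB => ?_
  have hAS : MeasurableSet[m] (A ∩ U ⁻¹' S) := hA.inter (hU hS)
  rw [Measure.map_apply (hU'.prodMk hV) (hS.prod hB),
    Measure.restrict_apply ((hU'.prodMk hV) (hS.prod hB)), Measure.compProd_apply_prod hS hB,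
    setLIntegral_map hS (κ.measurable_coe hB) hU',
    Measure.restrict_restrict (hU' hS), Set.inter_comm (U ⁻¹' S),
    ← h.measure_inter hU' hV hAS hB]
  congr 1
  ext ω
  simp only [Set.mem_inter_iff, Set.mem_preimage, Set.mem_prod]
  tauto

namespace Atom

variable {E : Type*} [MeasurableSpace E] {P : Kernel E E} [IsMarkovKernel P] (a : Atom P)

theorem taboo_apply (x : E) {A : Set E} (hA : MeasurableSet A) :
    a.taboo x A = P x A - a.s x * a.ν A := a.sub_apply x hA

theorem smul_residual (x : E) : (1 - a.s x) • a.residual x = a.taboo x := by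
  have := a.isProb
  ext A hA
  by_cases h : a.s x < 1
  · have h0 : 1 - a.s x ≠ 0 := (tsub_pos_of_lt h).ne'
    have h1 : 1 - a.s x ≠ ∞ := (tsub_le_self.trans_lt ENNReal.one_lt_top).ne
    simp only [residual, h, Kernel.coe_mk, if_true, smul_smul, ENNReal.mul_inv_cancel h0 h1,
      one_smul]
    rfl
  · have h1 : a.s x = 1 := le_antisymm (a.s_le_one x) (not_lt.1 h)
    have h2 : a.taboo x A = 0 := by
      refine le_antisymm ((measure_mono (Set.subset_univ A)).trans ?_) zero_le
      rw [a.taboo_apply x MeasurableSet.univ]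
      simp [h1]
    simp [h1, h2]

theorem taboo_add (x : E) {A : Set E} (hA : MeasurableSet A) :
    a.s x * a.ν A + a.taboo x A = P x A := by
  rw [a.taboo_apply x hA, add_tsub_cancel_of_le (a.minor x A hA)]

/-- Toss the coin at the current position. -/
noncomputable def toss : Kernel E (E × Bool) := Kernel.id ×ₖ a.coin

instance : IsMarkovKernel a.toss := by unfold toss; infer_instance

theorem lintegral_toss (x : E) {f : E × Bool → ℝ≥0∞} (hf : Measurable f) :
    ∫⁻ z, f z ∂a.toss x = a.s x * f (x, true) + (1 - a.s x) * f (x, false) := by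
  rw [toss, Kernel.prod_apply, Kernel.id_apply, Measure.dirac_prod, lintegral_map hf (by fun_prop)]
  simp [coin, lintegral_dirac]

theorem splitKernel_eq : a.splitKernel = a.toss ∘ₖ a.move := by
  ext1 z
  rw [splitKernel, Kernel.compProd_apply_eq_compProd_sectR, Kernel.sectR_prodMkLeft,
    Kernel.comp_apply, Measure.compProd_eq_comp_prod, toss]

instance : IsMarkovKernel a.splitKernel := by unfold splitKernel; infer_instance

theorem move_true (x : E) : a.move (x, true) = a.ν := by simp [move]

theorem move_false (x : E) : a.move (x, false) = a.residual x := by simp [move]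

theorem move_comp_toss : a.move ∘ₖ a.toss = P := by
  ext x A hA
  rw [Kernel.comp_apply' _ _ _ hA, a.lintegral_toss x (a.move.measurable_coe hA), move_true,
    move_false, ← a.taboo_add x hA, ← a.smul_residual, Measure.smul_apply, smul_eq_mul]

/-- This intertwining transfers facts between the chain and its split version: it yields both the
Markov property of X alone and the invariant law of the split chain. -/
theorem splitKernel_comp_toss : a.splitKernel ∘ₖ a.toss = a.toss ∘ₖ P := by
  rw [splitKernel_eq, Kernel.comp_assoc, move_comp_toss]

theorem map_fst_toss : a.toss.map Prod.fst = Kernel.id := by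
  rw [← Kernel.fst_eq, toss, Kernel.fst_prod]

theorem invariant_splitKernel {π : Measure E} (h : Kernel.Invariant P π) :
    Kernel.Invariant a.splitKernel (a.toss ∘ₘ π) := by
  rw [Kernel.Invariant, Measure.comp_assoc, splitKernel_comp_toss, ← Measure.comp_assoc, h.def]

end Atom

section SplitChain

variable {Ω E : Type*} [mE : MeasurableSpace E]

/-- The information available just before the coin `Y_n` is tossed: the chain `(X_i, Y_i)` for
`i < n`, and `X_n`. -/
@[reducible]
def tossPast (X : ℕ → Ω → E) (Y : ℕ → Ω → Bool) : ℕ → MeasurableSpace Ω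
  | 0 => mE.comap (X 0)
  | n + 1 => MeasurableSpace.comap
      (fun ω => ((fun i : Finset.Iic n => (X i ω, Y i ω)), X (n + 1) ω)) inferInstance

theorem measurable_tossPast (X : ℕ → Ω → E) (Y : ℕ → Ω → Bool) (n : ℕ) :
    Measurable[tossPast X Y n] (X n) := by
  cases n with
  | zero => exact comap_measurable _
  | succ n =>
    exact (measurable_snd (α := (i : Finset.Iic n) → E × Bool)).comp (comap_measurable _)

theorem past_le_tossPast (X : ℕ → Ω → E) (Y : ℕ → Ω → Bool) (n : ℕ) :
    past (fun n ω => (X n ω, Y n ω)) n ≤ tossPast X Y (n + 1) :=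
  past_le fun i hi =>
    (measurable_pi_apply (X := fun _ : Finset.Iic n => E × Bool) ⟨i, Finset.mem_Iic.2 hi⟩).comp
      ((measurable_fst (α := (i : Finset.Iic n) → E × Bool)).comp (comap_measurable _))

theorem tossPast_le {X : ℕ → Ω → E} {Y : ℕ → Ω → Bool} {m : MeasurableSpace Ω} {n : ℕ}
    (hX : Measurable[m] (X n)) (h : ∀ i < n, Measurable[m] fun ω => (X i ω, Y i ω)) :
    tossPast X Y n ≤ m := by
  cases n with
  | zero => exact hX.comap_le
  | succ n =>
    have h1 : Measurable[m] fun ω (i : Finset.Iic n) => (X i ω, Y i ω) :=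
      @measurable_pi_lambda Ω _ _ m _ _ fun i => h i (Nat.lt_succ_of_le (Finset.mem_Iic.1 i.2))
    exact (h1.prodMk hX).comap_le

theorem tossPast_le_past (X : ℕ → Ω → E) (Y : ℕ → Ω → Bool) (n : ℕ) :
    tossPast X Y n ≤ past (fun n ω => (X n ω, Y n ω)) n :=
  tossPast_le (measurable_fst.comp (measurable_past (fun n ω => (X n ω, Y n ω)) le_rfl))
    fun _ hi => measurable_past (fun n ω => (X n ω, Y n ω)) hi.le

theorem tossPast_mono (X : ℕ → Ω → E) (Y : ℕ → Ω → Bool) : Monotone (tossPast X Y) :=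
  monotone_nat_of_le_succ fun n => (tossPast_le_past X Y n).trans (past_le_tossPast X Y n)

variable [mΩ : MeasurableSpace Ω] {P : Kernel E E} [IsMarkovKernel P] {a : Atom P}
  {μ : Measure Ω} {X : ℕ → Ω → E} {Y : ℕ → Ω → Bool}

namespace IsSplitChain

theorem measurable_fst (h : IsSplitChain a μ X Y) (n : ℕ) : Measurable (X n) :=
  _root_.measurable_fst.comp (h.chain.measurable n)

theorem measurable_snd (h : IsSplitChain a μ X Y) (n : ℕ) : Measurable (Y n) :=
  _root_.measurable_snd.comp (h.chain.measurable n)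

theorem tossPast_le (h : IsSplitChain a μ X Y) (n : ℕ) : tossPast X Y n ≤ mΩ :=
  _root_.tossPast_le (h.measurable_fst n) fun i _ => h.chain.measurable i

variable [IsProbabilityMeasure μ] (h : IsSplitChain a μ X Y)

include h

theorem isMarkovWrt_past :
    IsMarkovWrt μ (past fun n ω => (X n ω, Y n ω)) (fun n ω => (X n ω, Y n ω)) a.splitKernel :=
  h.chain.isMarkovWrt

theorem step_coin (n : ℕ) : IsStep μ (tossPast X Y n) (X n) (Y n) a.coin := by
  cases n with
  | zero =>
    exact HasCondDistrib.isStep (κ := a.coin) (φ := id) measurable_id (h.measurable_fst 0)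
      (h.measurable_snd 0) (by simpa using h.init)
  | succ n =>
    have hc := h.chain.markov n
    -- The split step factors as a move followed by a toss that sees only the new position, so
    -- conditioning on that position as well leaves the coin kernel.
    have e : historyKernel a.splitKernel n =
        (a.move.comap (fun z : (i : Finset.Iic n) → (fun _ : ℕ => E × Bool) i =>
          z ⟨n, Finset.mem_Iic.mpr le_rfl⟩) (measurable_pi_apply _)) ⊗ₖ
          (a.coin.comap Prod.snd _root_.measurable_snd) := by
      ext1 z
      rw [Kernel.compProd_apply_eq_compProd_sectR, Kernel.comap_apply, historyKernel,
        Kernel.comap_apply, Atom.splitKernel, Kernel.compProd_apply_eq_compProd_sectR,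
        Kernel.sectR_prodMkLeft]
      rfl
    rw [e] at hc
    have h1 : Measurable fun ω (i : Finset.Iic n) => (X i ω, Y i ω) :=
      measurable_pi_lambda _ fun i => h.chain.measurable i
    exact HasCondDistrib.isStep (κ := a.coin) (φ := Prod.snd) _root_.measurable_snd
      (h1.prodMk (h.measurable_fst _))
      (h.measurable_snd _) hc.of_compProd

theorem step_toss (n : ℕ) :
    IsStep μ (tossPast X Y n) (X n) (fun ω => (X n ω, Y n ω)) a.toss :=
  (h.step_coin n).prodMk (h.tossPast_le n) (measurable_tossPast X Y n) (h.measurable_snd n)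

/-- Tossing the current coin and then moving averages out to `P`. The filtration contains the
earlier coins but not the current one, which would change the law of the next move. -/
theorem isMarkovWrt_tossPast : IsMarkovWrt μ (tossPast X Y) X P where
  mono := tossPast_mono X Y
  le := h.tossPast_le
  adapted := measurable_tossPast X Y
  step n := by
    have h1 := ((h.step_toss n).trans (h.isMarkovWrt_past.step n) (tossPast_le_past X Y n)).map
      (h.chain.measurable (n + 1)) _root_.measurable_fst
    rwa [a.splitKernel_comp_toss, Kernel.map_comp, a.map_fst_toss, Kernel.id_comp] at h1

theorem invariant_split {π : Measure E} (hπ : Kernel.Invariant P π) (h0 : μ.map (X 0) = π) :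
    Kernel.Invariant a.splitKernel (μ.map fun ω => (X 0 ω, Y 0 ω)) := by
  rw [(h.step_toss 0).map_eq, h0]
  exact a.invariant_splitKernel hπ

theorem hasStationaryLaw {π : Measure E} (hπ : Kernel.Invariant P π) (h0 : μ.map (X 0) = π) :
    HasStationaryLaw μ fun n ω => (X n ω, Y n ω) :=
  h.isMarkovWrt_past.hasStationaryLaw (h.invariant_split hπ h0)

end IsSplitChain

end SplitChain

/-! ### Recurrence of the atom -/

section Recurrence

variable {Ω E : Type*} [MeasurableSpace E] [mΩ : MeasurableSpace Ω] {μ : Measure Ω}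
  [IsFiniteMeasure μ] {P : Kernel E E} [IsMarkovKernel P]

theorem IsMarkovWrt.condExp_indicator {ℱ : ℕ → MeasurableSpace Ω} {Z : ℕ → Ω → E}
    (h : IsMarkovWrt μ ℱ Z P) (k : ℕ) {D : Set E} (hD : MeasurableSet D) :
    μ[(Z (k + 1) ⁻¹' D).indicator (1 : Ω → ℝ) | ℱ k] =ᵐ[μ] fun ω => (P (Z k ω)).real D := by
  have hmD : MeasurableSet (Z (k + 1) ⁻¹' D) := h.measurable (k + 1) hD
  have hmP : Measurable[ℱ k] fun ω => (P (Z k ω)).real D :=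
    (P.measurable_coe hD).ennreal_toReal.comp (h.adapted k)
  have hint : Integrable (fun ω => (P (Z k ω)).real D) μ :=
    Integrable.of_bound (hmP.mono (h.le k) le_rfl).aestronglyMeasurable 1
      (ae_of_all _ fun ω => by
        rw [Real.norm_of_nonneg measureReal_nonneg]; exact measureReal_le_one)
  refine (ae_eq_condExp_of_forall_setIntegral_eq (h.le k)
    ((integrable_const (1 : ℝ)).indicator hmD) (fun _ _ _ => hint.integrableOn) ?_
    hmP.stronglyMeasurable.aestronglyMeasurable).symm
  intro A hA _
  refine Eq.trans ?_ (integral_indicator_one hmD).symm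
  rw [measureReal_def, Measure.restrict_apply hmD, Set.inter_comm,
    (h.step k).measure_inter (h.measurable k) (h.measurable _) hA hD,
    ← integral_toReal]
  · rfl
  · exact ((P.measurable_coe hD).comp (h.measurable k)).aemeasurable
  · exact ae_of_all _ fun ω => measure_lt_top _ _

/-- Lévy's conditional Borel–Cantelli lemma, with the conditional probabilities given by the kernel.
-/
theorem IsMarkovWrt.frequently_mem_iff {ℱ : ℕ → MeasurableSpace Ω} {Z : ℕ → Ω → E}
    (h : IsMarkovWrt μ ℱ Z P) {D : Set E} (hD : MeasurableSet D) :
    ∀ᵐ ω ∂μ, (∃ᶠ n in atTop, Z n ω ∈ D) ↔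
      Tendsto (fun n => ∑ k ∈ Finset.range n, (P (Z k ω)).real D) atTop atTop := by
  let 𝒢 : Filtration ℕ mΩ := ⟨ℱ, h.mono, h.le⟩
  have h1 := ae_mem_limsup_atTop_iff (ℱ := 𝒢) μ (s := fun n => Z n ⁻¹' D)
    fun n => h.adapted n hD
  have h2 := ae_all_iff.2 fun k => h.condExp_indicator k hD
  filter_upwards [h1, h2] with ω h1 h2
  rw [mem_limsup_iff_frequently_mem] at h1
  simp only [Set.mem_preimage] at h1
  rw [h1]
  have : ∀ k, (μ[(Z (k + 1) ⁻¹' D).indicator (1 : Ω → ℝ) | 𝒢 k]) ω = (P (Z k ω)).real D := h2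
  simp only [this]

theorem IsMarkovWrt.ae_frequently_mem {ℱ : ℕ → MeasurableSpace Ω} {Z : ℕ → Ω → E}
    (h : IsMarkovWrt μ ℱ Z P) {φ : Measure E} (hP : IsHarrisRecurrent P φ) {C : Set E}
    (hC : MeasurableSet C) (hφ : 0 < φ C) : ∀ᵐ ω ∂μ, ∃ᶠ n in atTop, Z n ω ∈ C := by
  have hS : MeasurableSet {z : ℕ → E | ∃ᶠ n in atTop, z n ∈ C} := by
    have : {z : ℕ → E | ∃ᶠ n in atTop, z n ∈ C} =
        limsup (fun n => (fun z : ℕ → E => z n) ⁻¹' C) atTop := by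
      ext z; rw [mem_limsup_iff_frequently_mem]; rfl
    rw [this]
    exact MeasurableSet.measurableSet_limsup fun n => measurable_pi_apply n hC
  have hm : Measurable fun ω i => Z i ω := measurable_pi_lambda _ fun i => h.measurable i
  have h0 := (h.shift 0).map_eq
  simp only [zero_add] at h0
  have h1 : ∀ᵐ z ∂(μ.map fun ω i => Z i ω), ∃ᶠ n in atTop, z n ∈ C := by
    rw [h0, ae_iff, show {z : ℕ → E | ¬ ∃ᶠ n in atTop, z n ∈ C} =
      {z : ℕ → E | ∃ᶠ n in atTop, z n ∈ C}ᶜ from rfl,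
      Measure.bind_apply hS.compl (pathKernel P).aemeasurable]
    refine (lintegral_congr fun x => ?_).trans lintegral_zero
    exact ae_iff.1 (hP.2 C hC hφ x)
  exact (ae_map_iff hm.aemeasurable hS).1 h1

/-- For some ε > 0 the set {s ≥ ε} is φ-positive, so X visits it infinitely often and the
conditional probabilities of these visits sum to infinity. The conditional probability of a coin 1
is at least ε times that of a visit, so the converse half of Borel–Cantelli gives infinitely many
1s. -/
theorem IsSplitChain.ae_frequently_true [IsProbabilityMeasure μ] {a : Atom P}
    {X : ℕ → Ω → E} {Y : ℕ → Ω → Bool} (h : IsSplitChain a μ X Y) {φ : Measure E}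
    (hP : IsHarrisRecurrent P φ) (hs : 0 < φ {x | 0 < a.s x}) :
    ∀ᵐ ω ∂μ, ∃ᶠ t in atTop, Y t ω = true := by
  obtain ⟨n, hn⟩ : ∃ n : ℕ, 0 < φ {x | ((n + 1 : ℕ) : ℝ≥0∞)⁻¹ ≤ a.s x} := by
    refine exists_measure_pos_of_not_measure_iUnion_null fun h0 => hs.ne' ?_
    refine measure_mono_null (fun x hx => ?_) h0
    obtain ⟨n, hn⟩ := ENNReal.exists_inv_nat_lt (ne_of_gt hx)
    refine Set.mem_iUnion.2 ⟨n, le_trans ?_ hn.le⟩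
    exact ENNReal.inv_le_inv.2 (by exact_mod_cast Nat.le_succ n)
  set ε : ℝ≥0∞ := ((n + 1 : ℕ) : ℝ≥0∞)⁻¹ with hε
  have hε0 : 0 < ε.toReal :=
    ENNReal.toReal_pos (by simp [hε]) (by simp only [hε]; simp)
  have hC : MeasurableSet {x | ε ≤ a.s x} := measurableSet_le measurable_const a.measurable_s
  have h1 := h.isMarkovWrt_tossPast.ae_frequently_mem hP hC hn
  have hD : MeasurableSet ({x | ε ≤ a.s x} ×ˢ (Set.univ : Set Bool)) := hC.prod .univ
  have hD' : MeasurableSet ((Set.univ : Set E) ×ˢ ({true} : Set Bool)) := by measurability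
  have h2 := h.isMarkovWrt_past.frequently_mem_iff hD
  have h3 := h.isMarkovWrt_past.frequently_mem_iff hD'
  filter_upwards [h1, h2, h3] with ω h1 h2 h3
  have h1' : ∃ᶠ n in atTop, (X n ω, Y n ω) ∈ {x | ε ≤ a.s x} ×ˢ (Set.univ : Set Bool) :=
    h1.mono fun n hn => ⟨hn, trivial⟩
  have h3' : ∃ᶠ n in atTop, (X n ω, Y n ω) ∈ (Set.univ : Set E) ×ˢ ({true} : Set Bool) := by
    rw [h3]
    refine tendsto_atTop_mono (fun n => ?_) ((h2.1 h1').const_mul_atTop hε0)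
    rw [Finset.mul_sum]
    refine Finset.sum_le_sum fun k _ => ?_
    set z := (X k ω, Y k ω)
    rw [measureReal_def, measureReal_def, ← ENNReal.toReal_mul]
    refine ENNReal.toReal_mono (measure_ne_top _ _) ?_
    rw [a.splitKernel_eq, Kernel.comp_apply' _ _ _ hD, Kernel.comp_apply' _ _ _ hD',
      ← lintegral_const_mul _ (a.toss.measurable_coe hD)]
    refine lintegral_mono fun x => ?_
    have e : ∀ B : Set (E × Bool), MeasurableSet B → a.toss x B =
        a.s x * B.indicator 1 (x, true) + (1 - a.s x) * B.indicator 1 (x, false) := fun B hB => by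
      rw [← lintegral_indicator_one hB, a.lintegral_toss x (measurable_one.indicator hB)]
    rw [e _ hD, e _ hD']
    by_cases hx : ε ≤ a.s x
    · simp [hx, add_tsub_cancel_of_le (a.s_le_one x)]
    · simp [hx]
  exact h3'.mono fun n hn => hn.2

end Recurrence

/-! ### Regeneration times -/

namespace Atom

variable {E : Type*} [MeasurableSpace E] {P : Kernel E E} [IsMarkovKernel P] (a : Atom P)

/-- The coin shows `0` at the first `l` times, and `1` at time `l`. -/
def regenBox (E : Type*) (l i : ℕ) : Set (E × Bool) := {z | z.2 = decide (l ≤ i)}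

theorem measurableSet_regenBox (l i : ℕ) : MeasurableSet (regenBox E l i) :=
  measurable_snd (measurableSet_singleton (decide (l ≤ i)))

/-- A coin 0 followed by a move has weight (1 - s) Q, which is the taboo kernel; each zero before
the regeneration contributes one such factor. -/
theorem lintegral_boxProb_toss (l : ℕ) (x : E) :
    ∫⁻ z, boxProb a.splitKernel (l + 1) (regenBox E l) z ∂a.toss x =
      ∫⁻ y, a.s y ∂(a.taboo ^ l) x := by
  induction l generalizing x with
  | zero =>
    rw [a.lintegral_toss x (measurable_boxProb _ _ (measurableSet_regenBox 0)), pow_zero]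
    change _ = ∫⁻ y, a.s y ∂(Kernel.id x)
    rw [Kernel.id_apply, lintegral_dirac' _ a.measurable_s]
    simp [boxProb, regenBox]
  | succ l ih =>
    have hm : Measurable (boxProb a.splitKernel (l + 1) (regenBox E l)) :=
      measurable_boxProb _ _ (measurableSet_regenBox l)
    have e : (fun i => regenBox E (l + 1) (i + 1)) = regenBox E l := by
      funext i; simp [regenBox]
    rw [a.lintegral_toss x (measurable_boxProb _ _ (measurableSet_regenBox (l + 1))), boxProb, e,
      pow_succ]
    change _ = ∫⁻ y, a.s y ∂((a.taboo ^ l) ∘ₖ a.taboo) x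
    rw [Kernel.lintegral_comp _ _ _ a.measurable_s, ← a.smul_residual, lintegral_smul_measure,
      smul_eq_mul]
    simp_rw [← ih]
    rw [a.splitKernel_eq]
    simp [regenBox, Kernel.lintegral_comp _ _ _ (a.splitKernel_eq ▸ hm), move_false]

/-- The law of the time between two successive regenerations. -/
noncomputable def gapLaw : Measure ℕ := Measure.sum fun l => a.regenProb l • Measure.dirac (l + 1)

theorem gapLaw_succ (l : ℕ) : a.gapLaw {l + 1} = a.regenProb l := by
  rw [gapLaw, Measure.sum_apply _ (measurableSet_singleton _), tsum_eq_single l]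
  · simp
  · intro k hk
    simp [hk]

theorem gapLaw_zero : a.gapLaw {0} = 0 := by
  simp [gapLaw, Measure.sum_apply _ (measurableSet_singleton 0)]

theorem lintegral_gapLaw (f : ℕ → ℝ≥0∞) :
    ∫⁻ d, f d ∂a.gapLaw = ∑' l, a.regenProb l * f (l + 1) := by
  simp [gapLaw, lintegral_sum_measure, lintegral_smul_measure]

end Atom

/-! ### Pathwise description and measurability of the regeneration times. -/

section RegTime

variable {Ω : Type*} {m : MeasurableSpace Ω} {Y : ℕ → Ω → Bool}

/-- The `n`-th regeneration takes place at time `t`. -/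
def regAt (Y : ℕ → Ω → Bool) (n t : ℕ) : Set Ω :=
  {ω | Y t ω = true ∧ Nat.count (fun s => Y s ω = true) t = n}

theorem regTime_of_mem_regAt {n t : ℕ} {ω : Ω} (h : ω ∈ regAt Y n t) : regTime Y n ω = t := by
  rw [regTime, ← h.2]
  exact Nat.nth_count (p := fun s => Y s ω = true) h.1

theorem mem_regAt_regTime {ω : Ω} (h : ∃ᶠ t in atTop, Y t ω = true) (n : ℕ) :
    ω ∈ regAt Y n (regTime Y n ω) :=
  have hi := Nat.frequently_atTop_iff_infinite.1 h
  ⟨Nat.nth_mem_of_infinite hi n, Nat.count_nth_of_infinite hi n⟩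

theorem regTime_eq_iff {n t : ℕ} {ω : Ω} :
    regTime Y n ω = t ↔ ω ∈ regAt Y n t ∨ (t = 0 ∧ ∀ s, ω ∉ regAt Y n s) := by
  by_cases h : ∃ s, ω ∈ regAt Y n s
  · obtain ⟨s, hs⟩ := h
    rw [regTime_of_mem_regAt hs]
    constructor
    · rintro rfl; exact Or.inl hs
    · rintro (h | ⟨-, h⟩)
      · rw [← regTime_of_mem_regAt hs, regTime_of_mem_regAt h]
      · exact absurd hs (h s)
  · push Not at h
    -- With too few regenerations `Nat.nth` takes its default value 0, which accounts for the second
    -- alternative.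
    have h0 : regTime Y n ω = 0 := by
      have hi : ¬ {s | Y s ω = true}.Infinite := fun hi =>
        h _ (mem_regAt_regTime (Nat.frequently_atTop_iff_infinite.2 hi) n)
      have hf := Set.not_infinite.1 hi
      refine Nat.nth_of_card_le hf (not_lt.1 fun hlt => ?_)
      exact h _ ⟨Nat.nth_mem_of_lt_card hf hlt, Nat.count_nth fun _ => hlt⟩
    rw [h0]
    simp [h, eq_comm]

theorem measurable_count {t : ℕ} (hY : ∀ s < t, Measurable[m] (Y s)) :
    Measurable[m] fun ω => Nat.count (fun s => Y s ω = true) t := by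
  induction t with
  | zero => simp
  | succ t ih =>
    simp_rw [Nat.count_succ]
    exact (ih fun s hs => hY s (hs.trans (Nat.lt_succ_self t))).add
      (Measurable.ite (hY t (Nat.lt_succ_self t) (measurableSet_singleton true))
        measurable_const measurable_const)

theorem measurableSet_regAt {n t : ℕ} (hY : ∀ s ≤ t, Measurable[m] (Y s)) :
    MeasurableSet[m] (regAt Y n t) :=
  (hY t le_rfl (measurableSet_singleton true)).inter
    (measurable_count (fun s hs => hY s hs.le) (measurableSet_singleton n))

theorem measurable_regTime (hY : ∀ s, Measurable[m] (Y s)) (n : ℕ) :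
    Measurable[m] (regTime Y n) := by
  refine measurable_to_countable' fun t => ?_
  have e : regTime Y n ⁻¹' {t} =
      regAt Y n t ∪ {ω | t = 0 ∧ ∀ s, ω ∉ regAt Y n s} := by
    ext ω; exact regTime_eq_iff
  rw [e]
  refine (measurableSet_regAt fun s _ => hY s).union ((MeasurableSet.const _).inter ?_)
  change MeasurableSet[m] {ω | ∀ s, ω ∉ regAt Y n s}
  have : {ω | ∀ s, ω ∉ regAt Y n s} = ⋂ s, (regAt Y n s)ᶜ := by
    ext ω; simp
  rw [this]
  exact MeasurableSet.iInter fun s => (measurableSet_regAt fun s _ => hY s).compl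

theorem exists_mem_regAt {n t : ℕ} {ω : Ω} (h : n < Nat.count (fun s => Y s ω = true) t) :
    ∃ s < t, ω ∈ regAt Y n s := by
  induction t with
  | zero => simp at h
  | succ t ih =>
    rcases lt_or_ge n (Nat.count (fun s => Y s ω = true) t) with h1 | h1
    · obtain ⟨s, hs, h2⟩ := ih h1
      exact ⟨s, hs.trans (Nat.lt_succ_self t), h2⟩
    · rw [Nat.count_succ] at h
      split_ifs at h with hY
      · exact ⟨t, Nat.lt_succ_self t, hY, by omega⟩
      · omega

/-- The stopping-time property: on {τ_n = t}, whatever τ_0, …, τ_n determine is already determined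
by the coins up to time t. -/
theorem measurableSet_inter_regAt {n t : ℕ} {A : Set Ω}
    (hA : MeasurableSet[past (regTime Y) n] A) (hY : ∀ s ≤ t, Measurable[m] (Y s)) :
    MeasurableSet[m] (A ∩ regAt Y n t) := by
  obtain ⟨S, hS, rfl⟩ := hA
  -- Overwriting the coins after time t changes none of τ_0, …, τ_n when τ_n = t, and makes all
  -- coins measurable for `m`.
  set Y' : ℕ → Ω → Bool := fun s ω => if s ≤ t then Y s ω else true with hY'
  have hYm : ∀ s, Measurable[m] (Y' s) := fun s => by
    simp only [hY']
    split_ifs with h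
    exacts [hY s h, measurable_const]
  have e : (fun ω (i : Finset.Iic n) => regTime Y i ω) ⁻¹' S ∩ regAt Y n t =
      (fun ω (i : Finset.Iic n) => regTime Y' i ω) ⁻¹' S ∩ regAt Y n t := by
    ext ω
    refine and_congr_left fun hω => ?_
    have : (fun i : Finset.Iic n => regTime Y i ω) = fun i : Finset.Iic n => regTime Y' i ω := by
      funext i
      have hi := Finset.mem_Iic.1 i.2
      obtain ⟨s, hs, h1⟩ : ∃ s ≤ t, ω ∈ regAt Y i s := by
        rcases hi.lt_or_eq with h2 | h2
        · obtain ⟨s, hs, h1⟩ := exists_mem_regAt (h2.trans_eq hω.2.symm)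
          exact ⟨s, hs.le, h1⟩
        · exact ⟨t, le_rfl, by rw [h2]; exact hω⟩
      have h2 : ω ∈ regAt Y' i s := by
        refine ⟨by simpa [hY', hs] using h1.1, ?_⟩
        rw [← h1.2, Nat.count_eq_card_filter_range, Nat.count_eq_card_filter_range]
        congr 1
        refine Finset.filter_congr fun r hr => ?_
        have : r ≤ t := (Finset.mem_range.1 hr).le.trans hs
        simp [hY', this]
      rw [regTime_of_mem_regAt h1, regTime_of_mem_regAt h2]
    simp only [Set.mem_preimage, this]
  have hm : Measurable[m] fun ω (i : Finset.Iic n) => regTime Y' i ω :=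
    @measurable_pi_lambda Ω _ _ m _ _ fun i => measurable_regTime hYm i
  rw [e]
  exact (hm hS).inter (measurableSet_regAt hY)

/-- The time between the regenerations number `n` and `n + 1`. -/
noncomputable def regGap (Y : ℕ → Ω → Bool) (n : ℕ) (ω : Ω) : ℕ := regTime Y (n + 1) ω - regTime Y n ω

/-- Turns the event on the gap into a box for the coins after time t, to which the Markov property
applies. The gap is l + 1 because the wait l is counted from time t + 1. -/
theorem regAt_inter_regGap (Y : ℕ → Ω → Bool) (n t l : ℕ) :
    regAt Y n t ∩ regGap Y n ⁻¹' {l + 1} =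
      regAt Y n t ∩ {ω | ∀ i < l + 1, Y (t + 1 + i) ω = decide (l ≤ i)} := by
  ext ω
  refine and_congr_right fun hω => ?_
  have h1 : ω ∈ regGap Y n ⁻¹' {l + 1} ↔ ω ∈ regAt Y (n + 1) (t + 1 + l) := by
    have : ω ∈ regGap Y n ⁻¹' {l + 1} ↔ regTime Y (n + 1) ω = t + 1 + l := by
      simp only [Set.mem_preimage, regGap, regTime_of_mem_regAt hω, Set.mem_singleton_iff]
      omega
    rw [this, regTime_eq_iff]
    constructor
    · rintro (h | ⟨h, -⟩)
      exacts [h, by omega]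
    · exact Or.inl
  have h2 : Nat.count (fun s => Y s ω = true) (t + 1) = n + 1 := by
    rw [Nat.count_succ, hω.2, if_pos hω.1]
  rw [h1, regAt, Set.mem_ofPred_eq, Nat.count_add, h2]
  simp only [Nat.add_eq_left, Nat.count_eq_card_filter_range, Finset.card_eq_zero,
    Finset.filter_eq_empty_iff, Finset.mem_range, Set.mem_ofPred_eq]
  rw [Nat.forall_lt_succ_right, and_comm]
  refine and_congr (forall₂_congr fun i hi => ?_) (by simp)
  have : decide (l ≤ i) = false := by simpa using hi
  simp [this]

theorem regTime_strictMono {ω : Ω} (h : ∃ᶠ t in atTop, Y t ω = true) :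
    StrictMono fun n => regTime Y n ω :=
  Nat.nth_strictMono (Nat.frequently_atTop_iff_infinite.1 h)

theorem measurable_regGap (hY : ∀ s, Measurable[m] (Y s)) (n : ℕ) :
    Measurable[m] (regGap Y n) := (measurable_regTime hY _).sub (measurable_regTime hY _)

theorem measurable_regGap_past (Y : ℕ → Ω → Bool) {i n : ℕ} (h : i < n) :
    Measurable[past (regTime Y) n] (regGap Y i) :=
  (measurable_past (regTime Y) h).sub (measurable_past (regTime Y) h.le)

end RegTime

theorem tsum_measure_inter_regAt {Ω : Type*} [mΩ : MeasurableSpace Ω] {μ : Measure Ω}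
    {Y : ℕ → Ω → Bool} (hY : ∀ s, Measurable (Y s))
    (hrec : ∀ᵐ ω ∂μ, ∃ᶠ t in atTop, Y t ω = true) (n : ℕ) {B : Set Ω} (hB : MeasurableSet B) :
    μ B = ∑' t, μ (B ∩ regAt Y n t) := by
  rw [← measure_iUnion]
  · refine measure_congr ?_
    filter_upwards [hrec] with ω hω
    refine propext ⟨fun hωB => ?_, fun hω => ?_⟩
    · exact Set.mem_iUnion.2 ⟨_, hωB, mem_regAt_regTime hω n⟩
    · obtain ⟨t, ht⟩ := Set.mem_iUnion.1 hω
      exact ht.1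
  · intro s t hst
    refine Set.disjoint_left.2 fun ω h1 h2 => hst ?_
    rw [← regTime_of_mem_regAt h1.2, regTime_of_mem_regAt h2.2]
  · exact fun t => hB.inter (measurableSet_regAt fun s _ => hY s)

/-! ### The gaps between regenerations are i.i.d. -/

section GapLaw

variable {Ω E : Type*} [MeasurableSpace E] [mΩ : MeasurableSpace Ω] {μ : Measure Ω}
  [IsProbabilityMeasure μ] {P : Kernel E E} [IsMarkovKernel P] {a : Atom P}
  {X : ℕ → Ω → E} {Y : ℕ → Ω → Bool}

/-- On `A` the coin at time t is 1, so the next position has law ν whatever the past, and the wait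
for the next 1 is independent of `A`. -/
theorem IsSplitChain.measure_regGap (h : IsSplitChain a μ X Y) {n t : ℕ} (l : ℕ) {A : Set Ω}
    (hA : MeasurableSet[past (fun n ω => (X n ω, Y n ω)) t] A) (hsub : A ⊆ regAt Y n t) :
    μ (A ∩ regGap Y n ⁻¹' {l + 1}) = μ A * a.regenProb l := by
  have hM := h.isMarkovWrt_past
  have e : A ∩ regGap Y n ⁻¹' {l + 1} =
      A ∩ (fun ω i => (X (t + 1 + i) ω, Y (t + 1 + i) ω)) ⁻¹'
        pathBox (Atom.regenBox E l) (l + 1) := by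
    rw [← Set.inter_eq_left.2 hsub, Set.inter_assoc, regAt_inter_regGap, Set.inter_assoc]
    rfl
  have hS := Atom.measurableSet_regenBox (E := E) l
  have hm := measurable_boxProb a.splitKernel (l + 1) hS
  rw [e, hM.measure_inter_box (l + 1) (t + 1) (hM.mono (Nat.le_succ t) _ hA) hS,
    (hM.step t).setLIntegral (hM.measurable _) (hM.measurable _) hA hm]
  have hA' : MeasurableSet A := hM.le t _ hA
  rw [setLIntegral_congr_fun (g := fun _ => a.regenProb l) hA' fun ω hω => ?_]
  · simp [mul_comm]
  · have hY : Y t ω = true := (hsub hω).1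
    simp only [hY]
    rw [a.splitKernel_eq, Kernel.lintegral_comp _ _ _ (a.splitKernel_eq ▸ hm), a.move_true,
      Atom.regenProb, ← a.splitKernel_eq]
    simp_rw [a.lintegral_boxProb_toss]

variable (h : IsSplitChain a μ X Y) (hrec : ∀ᵐ ω ∂μ, ∃ᶠ t in atTop, Y t ω = true)

include h hrec

theorem IsSplitChain.step_regGap (n : ℕ) :
    IsStep μ (past (regTime Y) n) (regTime Y n) (regGap Y n) (Kernel.const ℕ a.gapLaw) := by
  have hτ := measurable_regTime h.measurable_snd
  have hle : past (regTime Y) n ≤ mΩ := past_le fun i _ => hτ i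
  have hg := measurable_regGap h.measurable_snd n
  intro A hA
  have hA' : MeasurableSet A := hle _ hA
  refine Measure.ext_of_singleton fun d => ?_
  rw [Measure.map_apply hg (measurableSet_singleton d),
    Measure.restrict_apply (hg (measurableSet_singleton d)), Set.inter_comm,
    Measure.bind_apply (measurableSet_singleton d) (Kernel.aemeasurable _)]
  simp only [Kernel.const_apply, lintegral_const, Measure.map_apply (hτ n) MeasurableSet.univ,
    Set.preimage_univ, Measure.restrict_apply_univ]
  cases d with
  | zero =>
    -- A zero gap arises only from default values, on the null set where regenerations stop.
    rw [a.gapLaw_zero, zero_mul]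
    refine measure_mono_null Set.inter_subset_right (ae_iff.1 (?_ : ∀ᵐ ω ∂μ, regGap Y n ω ≠ 0) ▸ ?_)
    · filter_upwards [hrec] with ω hω
      have : regTime Y n ω < regTime Y (n + 1) ω := regTime_strictMono hω (Nat.lt_add_one n)
      simp only [regGap]
      omega
    · simp [Set.preimage]
  | succ l =>
    rw [a.gapLaw_succ, tsum_measure_inter_regAt h.measurable_snd hrec n
      (hA'.inter (hg (measurableSet_singleton _))), tsum_measure_inter_regAt h.measurable_snd hrec n hA',
      ← ENNReal.tsum_mul_left]
    refine tsum_congr fun t => ?_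
    rw [mul_comm, ← h.measure_regGap l (t := t) (n := n) _ Set.inter_subset_right,
      Set.inter_right_comm]
    exact measurableSet_inter_regAt hA fun s hs =>
      _root_.measurable_snd.comp (measurable_past (fun n ω => (X n ω, Y n ω)) hs)

theorem IsSplitChain.map_regGap (n : ℕ) : μ.map (regGap Y n) = a.gapLaw := by
  have := (h.step_regGap hrec n).map_eq
  have hp : IsProbabilityMeasure (μ.map (regTime Y n)) :=
    Measure.isProbabilityMeasure_map (measurable_regTime h.measurable_snd n).aemeasurable
  rwa [Measure.const_comp, measure_univ, one_smul] at this

theorem IsSplitChain.isProbabilityMeasure_gapLaw : IsProbabilityMeasure a.gapLaw := by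
  rw [← h.map_regGap hrec 0]
  exact Measure.isProbabilityMeasure_map (measurable_regGap h.measurable_snd 0).aemeasurable

/-- The largest index is split off first: the earlier gaps are functions of the regeneration times
up to it, of which the last gap is independent. -/
theorem IsSplitChain.iIndepFun_regGap : iIndepFun (regGap Y) μ := by
  have hg := measurable_regGap h.measurable_snd
  rw [iIndepFun_iff_measure_inter_preimage_eq_mul]
  intro S sets _
  induction S using Finset.induction_on_max with
  | empty => simp
  | insert n S hn ih =>
    have hnS : n ∉ S := fun hS => (hn n hS).ne rfl
    have hA : MeasurableSet[past (regTime Y) n] (⋂ i ∈ S, regGap Y i ⁻¹' sets i) :=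
      Finset.measurableSet_biInter _ fun i hi =>
        measurable_regGap_past Y (hn i hi) (MeasurableSet.of_discrete)
    rw [Finset.set_biInter_insert, Finset.prod_insert hnS, ← ih fun _ _ => MeasurableSet.of_discrete,
      Set.inter_comm, (h.step_regGap hrec n).measure_inter (measurable_regTime h.measurable_snd n)
        (hg n) hA MeasurableSet.of_discrete,
      ← Measure.map_apply (hg n) MeasurableSet.of_discrete, h.map_regGap hrec]
    simp

end GapLaw

/-! ### Geometric ergodicity of the embedded kernel -/

section TotalVariation

variable {E : Type*} [MeasurableSpace E]

theorem ofReal_abs_sub_le_iff {κ η : Measure E} [IsFiniteMeasure κ] [IsFiniteMeasure η]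
    {D : ℝ≥0∞} (A : Set E) :
    ENNReal.ofReal |κ.real A - η.real A| ≤ D ↔ κ A ≤ η A + D ∧ η A ≤ κ A + D := by
  rcases eq_or_ne D ∞ with rfl | hD
  · simp
  · lift D to ℝ≥0 using hD
    have h1 : ∀ ρ ρ' : Measure E, IsFiniteMeasure ρ → IsFiniteMeasure ρ' →
        (ρ A ≤ ρ' A + D ↔ ρ.real A ≤ ρ'.real A + D) := fun ρ ρ' _ _ => by
      rw [← ENNReal.toReal_le_toReal (measure_ne_top _ _) (by finiteness),
        ENNReal.toReal_add (measure_ne_top _ _) ENNReal.coe_ne_top]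
      rfl
    rw [h1 κ η inferInstance inferInstance, h1 η κ inferInstance inferInstance,
      ENNReal.ofReal_le_iff_le_toReal ENNReal.coe_ne_top, ENNReal.coe_toReal, abs_le]
    constructor <;> rintro ⟨h1, h2⟩ <;> constructor <;> linarith

/-- The two-sided additive form avoids subtraction in `ℝ≥0∞` and can be averaged term by term. -/
theorem tvDist_le_iff {κ η : Measure E} [IsFiniteMeasure κ] [IsFiniteMeasure η] {D : ℝ≥0∞} :
    tvDist κ η ≤ D ↔ ∀ A, MeasurableSet A → κ A ≤ η A + D ∧ η A ≤ κ A + D := by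
  simp only [tvDist, iSup_le_iff, ofReal_abs_sub_le_iff]

theorem ProbabilityTheory.Kernel.Invariant.pow {P : Kernel E E} {π : Measure E}
    (h : Kernel.Invariant P π) (n : ℕ) : Kernel.Invariant (P ^ n) π := by
  induction n with
  | zero => exact Measure.id_comp
  | succ n ih => rw [pow_succ]; exact ih.comp h

instance ProbabilityTheory.Kernel.isMarkovKernel_pow {P : Kernel E E} [IsMarkovKernel P] (n : ℕ) :
    IsMarkovKernel (P ^ n) := by
  induction n with
  | zero => exact inferInstanceAs (IsMarkovKernel Kernel.id)
  | succ n ih => rw [pow_succ]; exact inferInstanceAs (IsMarkovKernel ((P ^ n) ∘ₖ P))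

end TotalVariation

/-! ### The embedded kernel as a mixture of powers. -/

section EmbeddedKernel

variable {E F : Type*} [MeasurableSpace E] [MeasurableSpace F] {P₁ : Kernel E E}
  [IsMarkovKernel P₁] (a : Atom P₁) (P : Kernel F F)

theorem embeddedKernel_apply (w : F) :
    embeddedKernel a P w = Measure.sum fun l => a.regenProb l • (P ^ (l + 1)) w := by
  ext C hC
  rw [embeddedKernel, Kernel.comp_apply' _ _ _ hC, Measure.sum_apply _ hC]
  simp only [mixtureKernel, Kernel.coe_mk, Measure.sum_apply _ hC, Measure.smul_apply,
    smul_eq_mul]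
  rw [lintegral_tsum fun l => (((P ^ l).measurable_coe hC).const_mul _).aemeasurable]
  refine tsum_congr fun l => ?_
  rw [lintegral_const_mul _ ((P ^ l).measurable_coe hC), pow_succ]
  change _ = _ * ((P ^ l) ∘ₖ P) w C
  rw [Kernel.comp_apply' _ _ _ hC]

theorem embeddedKernel_apply' (w : F) {C : Set F} (hC : MeasurableSet C) :
    embeddedKernel a P w C = ∫⁻ d, (P ^ d) w C ∂a.gapLaw := by
  rw [embeddedKernel_apply, Measure.sum_apply _ hC, a.lintegral_gapLaw]
  rfl

theorem embeddedKernel_comp_pow_apply (m : ℕ) (w : F) :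
    (embeddedKernel a P ∘ₖ (P ^ m)) w =
      Measure.sum fun l => a.regenProb l • (P ^ (l + 1 + m)) w := by
  ext C hC
  rw [Kernel.comp_apply' _ _ _ hC, Measure.sum_apply _ hC]
  simp only [embeddedKernel_apply, Measure.sum_apply _ hC, Measure.smul_apply, smul_eq_mul]
  rw [lintegral_tsum fun l => (((P ^ (l + 1)).measurable_coe hC).const_mul _).aemeasurable]
  refine tsum_congr fun l => ?_
  rw [lintegral_const_mul _ ((P ^ (l + 1)).measurable_coe hC), pow_add P (l + 1) m]
  change _ = _ * ((P ^ (l + 1)) ∘ₖ (P ^ m)) w C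
  rw [Kernel.comp_apply' _ _ _ hC]

variable [hρ : IsProbabilityMeasure a.gapLaw]

instance isMarkovKernel_embeddedKernel [IsMarkovKernel P] : IsMarkovKernel (embeddedKernel a P) :=
  ⟨fun w => ⟨by rw [embeddedKernel_apply' a P w .univ]; simp⟩⟩

theorem tsum_regenProb_mul (c : ℝ≥0∞) : ∑' l, a.regenProb l * c = c := by
  rw [← a.lintegral_gapLaw fun _ => c]
  simp

variable {P} {π : Measure F}

theorem invariant_embeddedKernel (h : Kernel.Invariant P π) :
    Kernel.Invariant (embeddedKernel a P) π := by
  refine Measure.ext fun C hC => ?_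
  rw [Measure.bind_apply hC (Kernel.aemeasurable _)]
  simp only [embeddedKernel_apply, Measure.sum_apply _ hC, Measure.smul_apply, smul_eq_mul]
  rw [lintegral_tsum fun l => (((P ^ (l + 1)).measurable_coe hC).const_mul _).aemeasurable,
    ← tsum_regenProb_mul a (π C)]
  refine tsum_congr fun l => ?_
  rw [lintegral_const_mul _ ((P ^ (l + 1)).measurable_coe hC),
    ← Measure.bind_apply hC (Kernel.aemeasurable _), (h.pow (l + 1)).def]

variable [IsMarkovKernel P] [IsProbabilityMeasure π]

/-- The extra factor `P ^ m` makes the induction close: one embedded step is a mixture of `P ^ (l +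
1)`, and these exponents accumulate in m. Each is at least 1, so n steps use at least n powers of
`P`. -/
theorem tvDist_embeddedKernel_pow_le (n m : ℕ) (w : F) {D : ℝ≥0∞}
    (hD : ∀ j, n + m ≤ j → tvDist ((P ^ j) w) π ≤ D) :
    tvDist (((embeddedKernel a P ^ n) ∘ₖ (P ^ m)) w) π ≤ D := by
  induction n generalizing m with
  | zero =>
    rw [pow_zero]
    change tvDist ((Kernel.id ∘ₖ (P ^ m)) w) π ≤ D
    rw [Kernel.id_comp]
    exact hD m (by omega)
  | succ n ih =>
    have e : ∀ A, MeasurableSet A → (((embeddedKernel a P ^ (n + 1)) ∘ₖ (P ^ m)) w) A =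
        ∑' l, a.regenProb l * (((embeddedKernel a P ^ n) ∘ₖ (P ^ (l + 1 + m))) w) A := by
      intro A hA
      rw [pow_succ]
      change ((((embeddedKernel a P ^ n) ∘ₖ embeddedKernel a P) ∘ₖ (P ^ m)) w) A = _
      rw [Kernel.comp_assoc, Kernel.comp_apply' _ _ _ hA, embeddedKernel_comp_pow_apply,
        lintegral_sum_measure]
      refine tsum_congr fun l => ?_
      rw [lintegral_smul_measure, Kernel.comp_apply' _ _ _ hA, smul_eq_mul]
    have h1 : ∀ l, tvDist (((embeddedKernel a P ^ n) ∘ₖ (P ^ (l + 1 + m))) w) π ≤ D :=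
      fun l => ih (l + 1 + m) fun j hj => hD j (by omega)
    rw [tvDist_le_iff]
    intro A hA
    rw [e A hA]
    constructor
    · rw [← tsum_regenProb_mul a (π A + D)]
      exact ENNReal.tsum_le_tsum fun l => mul_le_mul_right (tvDist_le_iff.1 (h1 l) A hA).1 _
    · rw [← tsum_regenProb_mul a D, ← ENNReal.tsum_add, ← tsum_regenProb_mul a (π A)]
      refine ENNReal.tsum_le_tsum fun l => ?_
      rw [← mul_add]
      exact mul_le_mul_right (tvDist_le_iff.1 (h1 l) A hA).2 _

theorem tvDist_embeddedKernel_le (n : ℕ) (w : F) {D : ℝ≥0∞}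
    (hD : ∀ j, n ≤ j → tvDist ((P ^ j) w) π ≤ D) :
    tvDist ((embeddedKernel a P ^ n) w) π ≤ D := by
  have h := tvDist_embeddedKernel_pow_le a n 0 w hD
  rw [pow_zero] at h
  change tvDist ((_ ∘ₖ Kernel.id) w) π ≤ D at h
  rwa [Kernel.comp_id] at h

theorem isErgodicKernel_embeddedKernel (h : IsErgodicKernel P π) :
    IsErgodicKernel (embeddedKernel a P) π := by
  refine ⟨invariant_embeddedKernel a h.1, fun w => ENNReal.tendsto_nhds_zero.2 fun ε hε => ?_⟩
  obtain ⟨N, hN⟩ := eventually_atTop.1 (ENNReal.tendsto_nhds_zero.1 (h.2 w) ε hε)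
  exact eventually_atTop.2 ⟨N, fun n hn =>
    tvDist_embeddedKernel_le a n w fun j hj => hN j (hn.trans hj)⟩

theorem isGeometricallyErgodic_embeddedKernel (h : IsGeometricallyErgodic P π) :
    IsGeometricallyErgodic (embeddedKernel a P) π := by
  obtain ⟨h0, ρ, M, hρ0, hρ1, hM, hM', h⟩ := h
  refine ⟨isErgodicKernel_embeddedKernel a h0, ρ, M, hρ0, hρ1, hM, hM', fun w n => ?_⟩
  refine tvDist_embeddedKernel_le a n w fun j hj => (h w j).trans (mul_le_mul_right ?_ _)
  exact pow_le_pow_right_of_le_one' (by exact_mod_cast hρ1.le) hj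

end EmbeddedKernel

/-! ### The embedded process -/

section EmbeddedProcess

variable {Ω F : Type*} [MeasurableSpace F] [mΩ : MeasurableSpace Ω] {μ : Measure Ω}

theorem measurable_eval_prod : Measurable fun p : ℕ × (ℕ → F) => p.2 p.1 :=
  measurable_from_prod_countable_right fun n => measurable_pi_apply n

theorem measurable_comp_prod : Measurable fun (p : (ℕ → ℕ) × (ℕ → F)) i => p.2 (p.1 i) :=
  measurable_pi_lambda _ fun i => measurable_eval_prod.comp (g := fun p : ℕ × (ℕ → F) => p.2 p.1)
    (f := fun p : (ℕ → ℕ) × (ℕ → F) => (p.1 i, p.2))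
    (((measurable_pi_apply i).comp measurable_fst).prodMk measurable_snd)

theorem measurable_embedded {Y : ℕ → Ω → Bool} {Z : ℕ → Ω → F} (hY : ∀ n, Measurable (Y n))
    (hZ : ∀ n, Measurable (Z n)) (k : ℕ) : Measurable (embedded Y Z k) :=
  measurable_eval_prod.comp
    ((measurable_regTime hY k).prodMk (measurable_pi_lambda _ fun i => hZ i))

theorem ProbabilityTheory.IndepFun.lintegral_pair {G H : Type*} [MeasurableSpace G]
    [MeasurableSpace H] [IsProbabilityMeasure μ] {U : Ω → G} {V : Ω → H} (h : IndepFun U V μ)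
    (hU : Measurable U) (hV : Measurable V) {f : G × H → ℝ≥0∞} (hf : Measurable f) :
    ∫⁻ ω, f (U ω, V ω) ∂μ = ∫⁻ ω, ∫⁻ ω', f (U ω, V ω') ∂μ ∂μ := by
  have hp := Measure.isProbabilityMeasure_map hV.aemeasurable (μ := μ)
  rw [← lintegral_map hf (hU.prodMk hV),
    (indepFun_iff_map_prod_eq_prod_map_map hU.aemeasurable hV.aemeasurable).1 h,
    lintegral_prod _ hf.aemeasurable, lintegral_map hf.lintegral_prod_right' hU]
  refine lintegral_congr fun ω => ?_
  exact lintegral_map (hf.comp measurable_prodMk_left) hV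

variable [IsProbabilityMeasure μ]

/-- Conditioning on the regeneration times. -/
theorem measure_embedded {Y : ℕ → Ω → Bool} {Z : ℕ → Ω → F} (hY : ∀ n, Measurable (Y n))
    (hZ : ∀ n, Measurable (Z n))
    (hi : IndepFun (fun ω n => regTime Y n ω) (fun ω n => Z n ω) μ) {C : Set (ℕ → F)}
    (hC : MeasurableSet C) :
    μ {ω | (fun n => embedded Y Z n ω) ∈ C} =
      ∫⁻ ω, μ {ω' | (fun n => Z (regTime Y n ω) ω') ∈ C} ∂μ := by
  have hτ : Measurable fun ω n => regTime Y n ω := measurable_pi_lambda _ (measurable_regTime hY)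
  have hZ' : Measurable fun ω n => Z n ω := measurable_pi_lambda _ hZ
  have h := hi.lintegral_pair hτ hZ'
    (f := fun p => C.indicator 1 fun i => p.2 (p.1 i))
    ((measurable_one.indicator hC).comp measurable_comp_prod)
  have e : ∀ T : Ω → ℕ → F, Measurable T → ∫⁻ ω, C.indicator 1 (T ω) ∂μ = μ {ω | T ω ∈ C} :=
    fun T hT => by
      rw [← lintegral_map (measurable_one.indicator hC) hT, lintegral_indicator_one hC,
        Measure.map_apply hT hC]
      rfl
  dsimp only at h
  refine (e (fun ω i => Z (regTime Y i ω) ω)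
    (measurable_comp_prod.comp (hτ.prodMk hZ'))).symm.trans (h.trans ?_)
  exact lintegral_congr fun ω => e _ (measurable_pi_lambda _ fun i => hZ _)

variable {E : Type*} [MeasurableSpace E] {P₁ : Kernel E E} [IsMarkovKernel P₁] {a : Atom P₁}
  {X : ℕ → Ω → E} {Y : ℕ → Ω → Bool} {P : Kernel F F} [IsMarkovKernel P]

theorem IsSplitChain.lintegral_past_regGap (h : IsSplitChain a μ X Y)
    (hrec : ∀ᵐ ω ∂μ, ∃ᶠ t in atTop, Y t ω = true) (n : ℕ)
    (G : (Finset.Iic n → ℕ) → ℕ → ℝ≥0∞) :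
    ∫⁻ ω, G (fun i => regTime Y i ω) (regGap Y n ω) ∂μ =
      ∫⁻ ω, ∫⁻ d, G (fun i => regTime Y i ω) d ∂a.gapLaw ∂μ := by
  have hτ : Measurable fun ω (i : Finset.Iic n) => regTime Y i ω :=
    measurable_pi_lambda _ fun i => measurable_regTime h.measurable_snd i
  have hg := measurable_regGap h.measurable_snd n
  have hi : IndepFun (fun ω (i : Finset.Iic n) => regTime Y i ω) (regGap Y n) μ := by
    rw [indepFun_iff_measure_inter_preimage_eq_mul]
    intro S T hS hT
    rw [(h.step_regGap hrec n).measure_inter (measurable_regTime h.measurable_snd n) hg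
      ⟨S, hS, rfl⟩ hT, ← Measure.map_apply hg hT, h.map_regGap hrec]
    simp [mul_comm]
  rw [hi.lintegral_pair hτ hg (f := fun p => G p.1 p.2) Measurable.of_discrete]
  refine lintegral_congr fun ω => ?_
  rw [← h.map_regGap hrec n, lintegral_map Measurable.of_discrete hg]

/-- With the times frozen, the next step has kernel `P ^ d`, d being the gap. The gap is independent
of the earlier times, so averaging over d gives the embedded kernel; then the times are unfrozen. -/
theorem IsSplitChain.isMarkovChain_embedded (h : IsSplitChain a μ X Y)
    (hrec : ∀ᵐ ω ∂μ, ∃ᶠ t in atTop, Y t ω = true) {ℱ : ℕ → MeasurableSpace Ω} {Z : ℕ → Ω → F}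
    (hZ : IsMarkovWrt μ ℱ Z P)
    (hi : IndepFun (fun ω n => regTime Y n ω) (fun ω n => Z n ω) μ) :
    IsMarkovChain μ (embedded Y Z) (embeddedKernel a P) := by
  have hρ := h.isProbabilityMeasure_gapLaw hrec
  have hY := h.measurable_snd
  have hτ : Measurable fun ω n => regTime Y n ω := measurable_pi_lambda _ (measurable_regTime hY)
  have hZ' : Measurable fun ω n => Z n ω := measurable_pi_lambda _ hZ.measurable
  have hm := measurable_embedded hY hZ.measurable
  refine IsMarkovChain.of_isStep hm fun n => ?_
  refine IsStep.of_measure_inter (hm n) (hm (n + 1)) ?_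
  rintro _ ⟨S, hS, rfl⟩ B hB
  have hrS : Measurable fun (z : ℕ → F) (i : Finset.Iic n) => z i :=
    measurable_pi_lambda _ fun i => measurable_pi_apply _
  have hC : MeasurableSet {z : ℕ → F | (fun i : Finset.Iic n => z i) ∈ S ∧ z (n + 1) ∈ B} :=
    (hrS hS).inter (measurable_pi_apply (n + 1) hB)
  let A : (Finset.Iic n → ℕ) → Set Ω := fun t => {ω | (fun i => Z (t i) ω) ∈ S}
  let last : Finset.Iic n := ⟨n, Finset.mem_Iic.2 le_rfl⟩
  have hA : ∀ t, MeasurableSet (A t) := fun t =>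
    (measurable_pi_lambda _ fun i => hZ.measurable (t i)) hS
  have h1 : ∀ᵐ ω ∂μ, μ {ω' | (fun n => Z (regTime Y n ω) ω') ∈
      {z : ℕ → F | (fun i : Finset.Iic n => z i) ∈ S ∧ z (n + 1) ∈ B}} =
      ∫⁻ ω' in A (fun i => regTime Y i ω), (P ^ regGap Y n ω) (Z (regTime Y n ω) ω') B ∂μ := by
    filter_upwards [hrec] with ω hω
    have hmono := regTime_strictMono hω
    have e : regTime Y (n + 1) ω = regTime Y n ω + regGap Y n ω := by
      have : regTime Y n ω < regTime Y (n + 1) ω := hmono (Nat.lt_add_one n)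
      simp only [regGap]; omega
    rw [← (hZ.step_add (regTime Y n ω) (regGap Y n ω)).measure_inter (hZ.measurable _)
      (hZ.measurable _) _ hB, ← e]
    · rfl
    · refine @measurable_pi_lambda Ω _ _ (ℱ _) _ _ (fun i => ?_) _ hS
      exact (hZ.adapted _).mono (hZ.mono (hmono.monotone (Finset.mem_Iic.1 i.2))) le_rfl
  have h2 : ∀ t, ∫⁻ d, ∫⁻ ω' in A t, (P ^ d) (Z (t last) ω') B ∂μ ∂a.gapLaw =
      ∫⁻ ω' in A t, embeddedKernel a P (Z (t last) ω') B ∂μ := fun t => by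
    simp_rw [embeddedKernel_apply' a P _ hB]
    rw [a.lintegral_gapLaw]
    simp_rw [a.lintegral_gapLaw]
    have hmP : ∀ l, Measurable fun ω' => (P ^ (l + 1)) (Z (t last) ω') B := fun l =>
      ((P ^ (l + 1)).measurable_coe hB).comp (hZ.measurable _)
    rw [lintegral_tsum fun l => ((hmP l).const_mul _).aemeasurable]
    refine tsum_congr fun l => ?_
    rw [lintegral_const_mul _ (hmP l)]
  have h3 := measure_embedded hY hZ.measurable hi hC
  rw [lintegral_congr_ae h1, h.lintegral_past_regGap hrec n
    fun t d => ∫⁻ ω' in A t, (P ^ d) (Z (t last) ω') B ∂μ] at h3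
  simp_rw [h2] at h3
  refine h3.trans ?_
  -- Unfreezing: the right-hand side of the claim is disintegrated over the times in the same way.
  have hf : Measurable fun p : (ℕ → ℕ) × (ℕ → F) =>
      {z : ℕ → F | (fun i : Finset.Iic n => z i) ∈ S}.indicator
        (fun z => embeddedKernel a P (z n) B) (fun i => p.2 (p.1 i)) :=
    ((((embeddedKernel a P).measurable_coe hB).comp (measurable_pi_apply n)).indicator
      (hrS hS)).comp measurable_comp_prod
  have h4 := hi.lintegral_pair hτ hZ' hf
  have hmr : Measurable fun ω (i : Finset.Iic n) => embedded Y Z i ω :=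
    measurable_pi_lambda _ fun i => hm i
  rw [← lintegral_indicator (hmr hS)]
  refine Eq.trans ?_ h4.symm
  refine lintegral_congr fun ω => ?_
  rw [← lintegral_indicator (hA _)]
  rfl

end EmbeddedProcess

/-! ### Mixing coefficients -/

section Mixing

/-- The probability that `Z`, observed at the times `t_0, t_1, …`, lies in `C`. -/
noncomputable def sampledProb {Ω E : Type*} [MeasurableSpace Ω] (μ : Measure Ω) (Z : ℕ → Ω → E)
    (C : Set (ℕ → E)) (t : ℕ → ℕ) : ℝ :=
  μ.real {ω | (fun i => Z (t i) ω) ∈ C}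

theorem sampledProb_nonneg {Ω E : Type*} [MeasurableSpace Ω] {μ : Measure Ω} {Z : ℕ → Ω → E}
    (C : Set (ℕ → E)) (t : ℕ → ℕ) : 0 ≤ sampledProb μ Z C t :=
  measureReal_nonneg

theorem sampledProb_le_one {Ω E : Type*} [MeasurableSpace Ω] {μ : Measure Ω}
    [IsProbabilityMeasure μ] {Z : ℕ → Ω → E} (C : Set (ℕ → E)) (t : ℕ → ℕ) :
    sampledProb μ Z C t ≤ 1 :=
  measureReal_le_one

variable {Ω E : Type*} [mE : MeasurableSpace E]

theorem iSup_comap_eq {ι : Type*} (Z : ι → Ω → E) :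
    ⨆ i, mE.comap (Z i) = MeasurableSpace.comap (fun ω i => Z i ω) MeasurableSpace.pi := by
  simp only [MeasurableSpace.pi, MeasurableSpace.comap_iSup, MeasurableSpace.comap_comp]
  rfl

variable [mΩ : MeasurableSpace Ω] {μ : Measure Ω} {Z : ℕ → Ω → E}

theorem mixingCoeff_le {l : ℕ} {c : ℝ}
    (h : ∀ (k : ℕ) (S : Set ({i : ℕ // i ≤ k} → E)) (T : Set ({i : ℕ // k + l ≤ i} → E)),
      MeasurableSet S → MeasurableSet T →
      |μ.real ({ω | (fun i : {i : ℕ // i ≤ k} => Z i ω) ∈ S} ∩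
          {ω | (fun i : {i : ℕ // k + l ≤ i} => Z i ω) ∈ T}) -
        μ.real {ω | (fun i : {i : ℕ // i ≤ k} => Z i ω) ∈ S} *
          μ.real {ω | (fun i : {i : ℕ // k + l ≤ i} => Z i ω) ∈ T}| ≤ c) :
    mixingCoeff μ Z l ≤ c := by
  refine csSup_le ⟨_, 0, ∅, ∅, @MeasurableSet.empty _ (_), @MeasurableSet.empty _ (_), rfl⟩ ?_
  rintro _ ⟨k, A, B, hA, hB, rfl⟩
  rw [iSup_comap_eq fun i : {i : ℕ // i ≤ k} => Z i] at hA
  rw [iSup_comap_eq fun i : {i : ℕ // k + l ≤ i} => Z i] at hB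
  obtain ⟨S, hS, rfl⟩ := hA
  obtain ⟨T, hT, rfl⟩ := hB
  exact h k S T hS hT

theorem HasStationaryLaw.sampledProb_add (h : HasStationaryLaw μ Z)
    (hZ : ∀ n, Measurable (Z n)) {C : Set (ℕ → E)} (hC : MeasurableSet C) (c : ℕ)
    (t : ℕ → ℕ) :
    sampledProb μ Z C (fun i => c + t i) = sampledProb μ Z C t := by
  have hC' : MeasurableSet {z : ℕ → E | (fun i => z (t i)) ∈ C} :=
    (measurable_pi_lambda _ fun i => measurable_pi_apply (t i)) hC
  have h1 := congrArg (fun ρ : Measure (ℕ → E) => ρ.real {z | (fun i => z (t i)) ∈ C}) (h c)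
  rw [map_measureReal_apply (measurable_pi_lambda _ fun i => hZ _) hC',
    map_measureReal_apply (measurable_pi_lambda _ fun i => hZ _) hC'] at h1
  exact h1

variable [IsProbabilityMeasure μ]

theorem abs_real_inter_sub_le_one (A B : Set Ω) :
    |μ.real (A ∩ B) - μ.real A * μ.real B| ≤ 1 := by
  have h1 : μ.real A * μ.real B ≤ 1 :=
    mul_le_one₀ measureReal_le_one measureReal_nonneg measureReal_le_one
  have h2 : 0 ≤ μ.real A * μ.real B := mul_nonneg measureReal_nonneg measureReal_nonneg
  have h3 : μ.real (A ∩ B) ≤ 1 := measureReal_le_one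
  have h4 : 0 ≤ μ.real (A ∩ B) := measureReal_nonneg
  rw [abs_le]
  constructor <;> linarith

theorem le_mixingCoeff {k l : ℕ} {A B : Set Ω}
    (hA : MeasurableSet[⨆ i : {i : ℕ // i ≤ k}, mE.comap (Z i)] A)
    (hB : MeasurableSet[⨆ i : {i : ℕ // k + l ≤ i}, mE.comap (Z i)] B) :
    |μ.real (A ∩ B) - μ.real A * μ.real B| ≤ mixingCoeff μ Z l := by
  -- Boundedness by 1 makes the real `sSup` a genuine supremum rather than the default 0.
  refine le_csSup ⟨1, ?_⟩ ⟨k, A, B, hA, hB, rfl⟩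
  rintro _ ⟨k, A, B, -, -, rfl⟩
  exact abs_real_inter_sub_le_one A B

theorem mixingCoeff_nonneg (l : ℕ) : 0 ≤ mixingCoeff μ Z l :=
  (abs_nonneg _).trans (le_mixingCoeff (k := 0) (l := l) (A := ∅) (B := ∅)
    (@MeasurableSet.empty _ (_)) (@MeasurableSet.empty _ (_)))

theorem measurable_measure_sampled (hZ : ∀ n, Measurable (Z n)) {C : Set (ℕ → E)}
    (hC : MeasurableSet C) :
    Measurable fun t : ℕ → ℕ => μ {ω | (fun i => Z (t i) ω) ∈ C} := by
  have h : Measurable fun (p : (ℕ → ℕ) × Ω) i => Z (p.1 i) p.2 :=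
    measurable_comp_prod.comp
      (measurable_fst.prodMk ((measurable_pi_lambda _ hZ).comp measurable_snd))
  exact measurable_measure_prodMk_left (ν := μ) (h hC)

theorem measurable_sampledProb (hZ : ∀ n, Measurable (Z n)) {C : Set (ℕ → E)}
    (hC : MeasurableSet C) : Measurable (sampledProb μ Z C) :=
  (measurable_measure_sampled hZ hC).ennreal_toReal

theorem integrable_sampledProb (hZ : ∀ n, Measurable (Z n)) {C : Set (ℕ → E)}
    (hC : MeasurableSet C) {q : Ω → ℕ → ℕ} (hq : Measurable q) :
    Integrable (fun ω => sampledProb μ Z C (q ω)) μ :=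
  Integrable.of_bound ((measurable_sampledProb hZ hC).comp hq).aestronglyMeasurable 1
    (ae_of_all _ fun ω => by
      rw [Real.norm_of_nonneg (sampledProb_nonneg _ _)]; exact sampledProb_le_one _ _)

theorem real_embedded {Y : ℕ → Ω → Bool} (hY : ∀ n, Measurable (Y n))
    (hZ : ∀ n, Measurable (Z n))
    (hi : IndepFun (fun ω n => regTime Y n ω) (fun ω n => Z n ω) μ) {C : Set (ℕ → E)}
    (hC : MeasurableSet C) :
    μ.real {ω | (fun n => embedded Y Z n ω) ∈ C} =
      ∫ ω, sampledProb μ Z C (fun n => regTime Y n ω) ∂μ := by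
  have hτ : Measurable fun ω n => regTime Y n ω := measurable_pi_lambda _ (measurable_regTime hY)
  rw [measureReal_def, measure_embedded hY hZ hi hC]
  exact (integral_toReal ((measurable_measure_sampled hZ hC).comp hτ).aemeasurable
    (ae_of_all _ fun _ => measure_lt_top _ _)).symm

end Mixing

/-! ### Mixing of a stationary process read at regeneration times. -/

section EmbeddedMixing

theorem regTime_eq_add_sum {Ω : Type*} {Y : ℕ → Ω → Bool} {ω : Ω}
    (h : ∃ᶠ t in atTop, Y t ω = true) {m i : ℕ} (hmi : m ≤ i) :
    regTime Y i ω = regTime Y m ω + ∑ j ∈ Finset.Ico m i, regGap Y j ω := by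
  induction i, hmi using Nat.le_induction with
  | base => simp
  | succ i hi ih =>
    rw [Finset.sum_Ico_succ_top hi, ← add_assoc, ← ih, regGap]
    have := (regTime_strictMono h (Nat.lt_add_one i)).le
    simp only at this
    omega

variable {Ω E F : Type*} [mF : MeasurableSpace F] [mΩ : MeasurableSpace Ω] {μ : Measure Ω}
  [IsProbabilityMeasure μ] [MeasurableSpace E] {P₁ : Kernel E E} [IsMarkovKernel P₁]
  {a : Atom P₁} {X : ℕ → Ω → E} {Y : ℕ → Ω → Bool} {Z : ℕ → Ω → F}

/-- Stated for any stationary process independent of the times, since it is applied both to W and to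
the coins of the second chain. The covariance is the mean of the frozen covariances plus the
covariance of the two conditional probabilities, and the latter vanishes. -/
theorem IsSplitChain.mixingCoeff_embedded_le (h : IsSplitChain a μ X Y)
    (hrec : ∀ᵐ ω ∂μ, ∃ᶠ t in atTop, Y t ω = true) (hZ : ∀ n, Measurable (Z n))
    (hs : HasStationaryLaw μ Z)
    (hi : IndepFun (fun ω n => regTime Y n ω) (fun ω n => Z n ω) μ) (l : ℕ) :
    mixingCoeff μ (embedded Y Z) l ≤ mixingCoeff μ Z l := by
  have hY := h.measurable_snd
  have hτ : Measurable fun ω n => regTime Y n ω := measurable_pi_lambda _ (measurable_regTime hY)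
  refine mixingCoeff_le fun k S T hS hT => ?_
  set CA : Set (ℕ → F) := {z | (fun i : {i : ℕ // i ≤ k} => z i) ∈ S} with hCA
  set CB : Set (ℕ → F) := {z | (fun i : {i : ℕ // k + l ≤ i} => z i) ∈ T} with hCB
  have hA : MeasurableSet CA := (measurable_pi_lambda _ fun i => measurable_pi_apply _) hS
  have hB : MeasurableSet CB := (measurable_pi_lambda _ fun i => measurable_pi_apply _) hT
  -- Times relative to τ_0 and to τ_{k+l}. The truncation at k leaves `CA` unaffected and makes
  -- every coordinate of `q` a function of the gaps before k.
  let q : Ω → ℕ → ℕ := fun ω i => ∑ j ∈ Finset.Ico 0 (min i k), regGap Y j ω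
  let r : Ω → ℕ → ℕ := fun ω i => ∑ j ∈ Finset.Ico (k + l) i, regGap Y j ω
  have hfq : ∀ᵐ ω ∂μ, sampledProb μ Z CA (fun n => regTime Y n ω) = sampledProb μ Z CA (q ω) := by
    filter_upwards [hrec] with ω hω
    rw [← hs.sampledProb_add hZ hA (regTime Y 0 ω) (q ω)]
    have e : ∀ i ≤ k, regTime Y i ω = regTime Y 0 ω + q ω i := fun i hik => by
      rw [regTime_eq_add_sum hω (Nat.zero_le i)]
      simp only [q, min_eq_left hik]
    have e' : (fun ω' (i : {i : ℕ // i ≤ k}) => Z (regTime Y i ω) ω') =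
        fun ω' (i : {i : ℕ // i ≤ k}) => Z (regTime Y 0 ω + q ω i) ω' := by
      funext ω' i; rw [e i i.2]
    exact congrArg (fun f : Ω → {i : ℕ // i ≤ k} → F => μ.real {ω' | f ω' ∈ S}) e'
  have hgr : ∀ᵐ ω ∂μ, sampledProb μ Z CB (fun n => regTime Y n ω) = sampledProb μ Z CB (r ω) := by
    filter_upwards [hrec] with ω hω
    rw [← hs.sampledProb_add hZ hB (regTime Y (k + l) ω) (r ω)]
    have e : ∀ i, k + l ≤ i → regTime Y i ω = regTime Y (k + l) ω + r ω i := fun i hik => by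
      rw [regTime_eq_add_sum hω hik]
    have e' : (fun ω' (i : {i : ℕ // k + l ≤ i}) => Z (regTime Y i ω) ω') =
        fun ω' (i : {i : ℕ // k + l ≤ i}) => Z (regTime Y (k + l) ω + r ω i) ω' := by
      funext ω' i; rw [e i i.2]
    exact congrArg (fun f : Ω → {i : ℕ // k + l ≤ i} → F => μ.real {ω' | f ω' ∈ T}) e'
  have hg := measurable_regGap hY
  have hq : Measurable[⨆ i ∈ Set.Iio k, MeasurableSpace.comap (regGap Y i) inferInstance] q :=
    @measurable_pi_lambda Ω _ _ (_) _ _ fun i => Finset.measurable_sum _ fun j hj =>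
      (comap_measurable (regGap Y j)).mono
        (le_iSup₂_of_le (f := fun i (_ : i ∈ Set.Iio k) =>
          MeasurableSpace.comap (regGap Y i) inferInstance) j
          (by simp at hj; exact hj.2) le_rfl) le_rfl
  have hr : Measurable[⨆ i ∈ Set.Ici (k + l), MeasurableSpace.comap (regGap Y i) inferInstance]
      r :=
    @measurable_pi_lambda Ω _ _ (_) _ _ fun i => Finset.measurable_sum _ fun j hj =>
      (comap_measurable (regGap Y j)).mono
        (le_iSup₂_of_le (f := fun i (_ : i ∈ Set.Ici (k + l)) =>
          MeasurableSpace.comap (regGap Y i) inferInstance) j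
          (by simp at hj; exact hj.1) le_rfl) le_rfl
  have hind : IndepFun q r μ := by
    have h1 := indep_iSup_of_disjoint (fun i => (hg i).comap_le) (h.iIndepFun_regGap hrec).iIndep
      (S := Set.Iio k) (T := Set.Ici (k + l))
      (Set.disjoint_left.2 fun i h1 h2 => by simp at h1 h2; omega)
    exact indep_of_indep_of_le_left (indep_of_indep_of_le_right h1 hr.comap_le) hq.comap_le
  have hq' : Measurable q := hq.mono (iSup₂_le fun i _ => (hg i).comap_le) le_rfl
  have hr' : Measurable r := hr.mono (iSup₂_le fun i _ => (hg i).comap_le) le_rfl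
  have hprod : ∫ ω, sampledProb μ Z CA (fun n => regTime Y n ω) *
      sampledProb μ Z CB (fun n => regTime Y n ω) ∂μ =
      (∫ ω, sampledProb μ Z CA (fun n => regTime Y n ω) ∂μ) *
        ∫ ω, sampledProb μ Z CB (fun n => regTime Y n ω) ∂μ := by
    rw [integral_congr_ae hfq, integral_congr_ae hgr]
    have h1 := (hind.comp (measurable_sampledProb (μ := μ) hZ hA)
      (measurable_sampledProb (μ := μ) hZ hB)).integral_mul_eq_mul_integral
      (integrable_sampledProb hZ hA hq').aestronglyMeasurable
      (integrable_sampledProb hZ hB hr').aestronglyMeasurable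
    refine Eq.trans (integral_congr_ae ?_) h1
    filter_upwards [hfq, hgr] with ω h1 h2
    rw [h1, h2]
    rfl
  -- For frozen times the two events concern Z up to τ_k and from τ_{k+l} ≥ τ_k + l on.
  have hcov : ∀ᵐ ω ∂μ, ‖sampledProb μ Z (CA ∩ CB) (fun n => regTime Y n ω) -
      sampledProb μ Z CA (fun n => regTime Y n ω) * sampledProb μ Z CB (fun n => regTime Y n ω)‖ ≤
      mixingCoeff μ Z l := by
    filter_upwards [hrec] with ω hω
    have hmono := regTime_strictMono hω
    have hkl : regTime Y k ω + l ≤ regTime Y (k + l) ω := by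
      rw [add_comm _ l, add_comm k l]
      exact hmono.add_le_nat l k
    refine le_mixingCoeff (k := regTime Y k ω) ?_ ?_
    · refine @measurable_pi_lambda Ω _ _ (_) _ _ (fun i => ?_) _ hS
      exact (comap_measurable (Z (regTime Y i ω))).mono
        (le_iSup_of_le (f := fun i : {j : ℕ // j ≤ regTime Y k ω} => mF.comap (Z i))
          ⟨regTime Y i ω, hmono.monotone i.2⟩ le_rfl) le_rfl
    · refine @measurable_pi_lambda Ω _ _ (_) _ _ (fun i => ?_) _ hT
      exact (comap_measurable (Z (regTime Y i ω))).mono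
        (le_iSup_of_le (f := fun i : {j : ℕ // regTime Y k ω + l ≤ j} => mF.comap (Z i))
          ⟨regTime Y i ω, hkl.trans (hmono.monotone i.2)⟩ le_rfl) le_rfl
  have hint : Integrable (fun ω => sampledProb μ Z CA (fun n => regTime Y n ω) *
      sampledProb μ Z CB (fun n => regTime Y n ω)) μ :=
    (integrable_sampledProb hZ hB hτ).bdd_mul (c := 1)
      (integrable_sampledProb hZ hA hτ).aestronglyMeasurable
      (ae_of_all _ fun ω => by
        rw [Real.norm_of_nonneg (sampledProb_nonneg _ _)]; exact sampledProb_le_one _ _)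
  have e1 := real_embedded hY hZ hi hA
  have e2 := real_embedded hY hZ hi hB
  have e3 := real_embedded hY hZ hi (hA.inter hB)
  have h5 := norm_integral_le_of_norm_le_const hcov
  rw [integral_sub (integrable_sampledProb hZ (hA.inter hB) hτ) hint, hprod, ← e1, ← e2, ← e3,
    probReal_univ, mul_one] at h5
  exact h5

end EmbeddedMixing

/-! ### Mixing of the coins -/

section CoinMixing

/-- Layer-cake formula: only levels in (0, 1] matter, and the error at each is at most D. -/
theorem lintegral_le_of_tvDist_le {E : Type*} [MeasurableSpace E] {κ η : Measure E}
    [IsFiniteMeasure κ] [IsFiniteMeasure η] {D : ℝ≥0∞} (h : tvDist κ η ≤ D) {f : E → ℝ≥0∞}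
    (hf : Measurable f) (hf1 : ∀ x, f x ≤ 1) :
    ∫⁻ x, f x ∂κ ≤ ∫⁻ x, f x ∂η + D ∧ ∫⁻ x, f x ∂η ≤ ∫⁻ x, f x ∂κ + D := by
  have hlc : ∀ ρ : Measure E, ∫⁻ x, f x ∂ρ = ∫⁻ t in Set.Ioi (0 : ℝ), ρ {x | t ≤ (f x).toReal} :=
    fun ρ => by
      rw [← lintegral_eq_lintegral_meas_le ρ (ae_of_all _ fun _ => ENNReal.toReal_nonneg)
        hf.ennreal_toReal.aemeasurable]
      exact lintegral_congr fun x =>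
        (ENNReal.ofReal_toReal ((hf1 x).trans_lt ENNReal.one_lt_top).ne).symm
  have hD : ∫⁻ t in Set.Ioi (0 : ℝ), (Set.Iic (1 : ℝ)).indicator (fun _ => D) t = D := by
    rw [lintegral_indicator measurableSet_Iic, Measure.restrict_restrict measurableSet_Iic,
      Set.inter_comm, Set.Ioi_inter_Iic]
    simp
  have key : ∀ ρ ρ' : Measure E, (∀ A, MeasurableSet A → ρ A ≤ ρ' A + D) →
      ∫⁻ x, f x ∂ρ ≤ ∫⁻ x, f x ∂ρ' + D := fun ρ ρ' hρ => by
    conv_rhs => rw [← hD]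
    rw [hlc ρ, hlc ρ', ← lintegral_add_right _ (measurable_const.indicator measurableSet_Iic)]
    refine lintegral_mono fun t => ?_
    by_cases ht : t ≤ 1
    · simp only [Set.indicator_of_mem (Set.mem_Iic.2 ht)]
      exact hρ _ (measurableSet_le measurable_const hf.ennreal_toReal)
    · have : {x | t ≤ (f x).toReal} = ∅ := by
        ext x
        simp only [Set.mem_ofPred_eq, Set.mem_empty_iff_false, iff_false, not_le]
        exact lt_of_le_of_lt (ENNReal.toReal_mono ENNReal.one_ne_top (hf1 x)) (by simpa using ht)
      simp [this]
  rw [tvDist_le_iff] at h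
  exact ⟨key κ η fun A hA => (h A hA).1, key η κ fun A hA => (h A hA).2⟩

/-- Among the events `A` prior to `B`, the covariance of `A` and `B` is extremal when `A` is a
level set of the conditional probability of `B`. -/
theorem abs_real_inter_sub_le_of_isStep {Ω E F : Type*} [MeasurableSpace E] [MeasurableSpace F]
    {m : MeasurableSpace Ω} [mΩ : MeasurableSpace Ω] {μ : Measure Ω} [IsProbabilityMeasure μ]
    (hm : m ≤ mΩ) {U : Ω → E} {V : Ω → F} {κ : Kernel E F} [IsMarkovKernel κ]
    (hU : Measurable[m] U) (hV : Measurable V) (h : IsStep μ m U V κ) {B : Set F}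
    (hB : MeasurableSet B) {c : ℝ}
    (hc : ∀ C, MeasurableSet C →
      |μ.real (U ⁻¹' C ∩ V ⁻¹' B) - μ.real (U ⁻¹' C) * μ.real (V ⁻¹' B)| ≤ c)
    {A : Set Ω} (hA : MeasurableSet[m] A) :
    |μ.real (A ∩ V ⁻¹' B) - μ.real A * μ.real (V ⁻¹' B)| ≤ c := by
  have hU' : Measurable U := hU.mono hm le_rfl
  have hu : Measurable fun x => (κ x).real B := (κ.measurable_coe hB).ennreal_toReal
  set b := μ.real (V ⁻¹' B)
  set w : Ω → ℝ := fun ω => (κ (U ω)).real B - b with hw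
  have hwm : Measurable w := (hu.comp hU').sub_const b
  have hint : Integrable (fun ω => (κ (U ω)).real B) μ :=
    Integrable.of_bound (hu.comp hU').aestronglyMeasurable 1 (ae_of_all _ fun ω => by
      rw [Real.norm_of_nonneg measureReal_nonneg]; exact measureReal_le_one)
  have hwi : Integrable w μ := hint.sub (integrable_const b)
  have hcov : ∀ S, MeasurableSet[m] S →
      μ.real (S ∩ V ⁻¹' B) - μ.real S * b = ∫ ω in S, w ω ∂μ := fun S hS => by
    simp only [hw]
    rw [integral_sub hint.integrableOn (integrable_const b), setIntegral_const, smul_eq_mul,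
      measureReal_def, h.measure_inter hU' hV hS hB]
    congr 1
    exact (integral_toReal ((κ.measurable_coe hB).comp hU').aemeasurable
      (ae_of_all _ fun _ => measure_lt_top _ _)).symm
  -- The integral of w over any A lies between its integrals over {w < 0} and {w > 0}, both of which
  -- are events about U.
  have hCm : MeasurableSet {x | 0 < (κ x).real B - b} :=
    measurableSet_lt measurable_const (hu.sub_const b)
  have hCm' : MeasurableSet {x | (κ x).real B - b < 0} :=
    measurableSet_lt (hu.sub_const b) measurable_const
  have h1 := hc _ hCm
  have h2 := hc _ hCm'
  rw [hcov _ (hU hCm)] at h1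
  rw [hcov _ (hU hCm')] at h2
  rw [hcov A hA, abs_le]
  have hA' := hm _ hA
  constructor
  · refine (abs_le.1 h2).1.trans ?_
    rw [← integral_indicator (hU' hCm'), ← integral_indicator hA']
    refine integral_mono (hwi.indicator (hU' hCm')) (hwi.indicator hA') fun ω => ?_
    by_cases h3 : w ω < 0
    · rw [Set.indicator_of_mem (show ω ∈ U ⁻¹' {x | (κ x).real B - b < 0} from h3)]
      exact Set.le_indicator_apply (fun _ => le_rfl) fun _ => h3.le
    · rw [Set.indicator_of_notMem (show ω ∉ U ⁻¹' {x | (κ x).real B - b < 0} from h3)]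
      exact Set.indicator_apply_nonneg fun _ => not_lt.1 h3
  · refine le_trans ?_ (abs_le.1 h1).2
    rw [← integral_indicator (hU' hCm), ← integral_indicator hA']
    refine integral_mono (hwi.indicator hA') (hwi.indicator (hU' hCm)) fun ω => ?_
    by_cases h3 : 0 < w ω
    · rw [Set.indicator_of_mem (show ω ∈ U ⁻¹' {x | 0 < (κ x).real B - b} from h3)]
      exact Set.indicator_apply_le' (fun _ => le_rfl) fun _ => h3.le
    · rw [Set.indicator_of_notMem (show ω ∉ U ⁻¹' {x | 0 < (κ x).real B - b} from h3)]
      exact Set.indicator_nonpos (fun _ _ => not_lt.1 h3) ω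

variable {Ω E : Type*} [mE : MeasurableSpace E] [mΩ : MeasurableSpace Ω] {P : Kernel E E}
  [IsMarkovKernel P] {a : Atom P} {μ : Measure Ω} [IsProbabilityMeasure μ] {X : ℕ → Ω → E}
  {Y : ℕ → Ω → Bool}

/-- The past coins enter only through X at time k + 1: the extremal past event is a level set of the
conditional probability given that position. The future coins enter through a [0, 1]-valued function
of X at time k + 1 + l. One time unit is lost because the coin at time k influences the move to time
k + 1. -/
theorem IsSplitChain.mixingCoeff_coin_le (h : IsSplitChain a μ X Y) (l : ℕ) :
    mixingCoeff μ Y (l + 1) ≤ mixingCoeff μ X l := by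
  refine mixingCoeff_le fun k S T hS hT => ?_
  set n := k + 1 + l with hn
  have hXm := h.measurable_fst
  let V : Ω → ℕ → E × Bool := fun ω i => (X (n + i) ω, Y (n + i) ω)
  have hV : Measurable V := measurable_pi_lambda _ fun i => h.chain.measurable (n + i)
  set B : Set (ℕ → E × Bool) := {v | (fun i : {i : ℕ // k + (l + 1) ≤ i} => (v (i - n)).2) ∈ T}
    with hB'
  have hB : MeasurableSet B :=
    (measurable_pi_lambda _ fun i => _root_.measurable_snd.comp (measurable_pi_apply _)) hT
  have eB : {ω | (fun i : {i : ℕ // k + (l + 1) ≤ i} => Y i ω) ∈ T} = V ⁻¹' B := by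
    have : ∀ ω, (fun i : {i : ℕ // k + (l + 1) ≤ i} => Y i ω) =
        fun i : {i : ℕ // k + (l + 1) ≤ i} => Y (n + (i - n)) ω := fun ω => by
      funext i
      have := i.2
      rw [show n + ((i : ℕ) - n) = i by omega]
    simp only [this]
    rfl
  have hstep : IsStep μ (tossPast X Y n) (X n) V (pathKernel a.splitKernel ∘ₖ a.toss) :=
    (h.step_toss n).trans (h.isMarkovWrt_past.shift n) (tossPast_le_past X Y n)
  have hstep' := (h.isMarkovWrt_tossPast.step_add (k + 1) l).trans hstep
    (tossPast_mono X Y (Nat.le_add_right _ _))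
  have hA : MeasurableSet[tossPast X Y (k + 1)] {ω | (fun i : {i : ℕ // i ≤ k} => Y i ω) ∈ S} := by
    refine @measurable_pi_lambda Ω _ _ (_) _ _ (fun i => ?_) _ hS
    exact (_root_.measurable_snd.comp (measurable_past (fun n ω => (X n ω, Y n ω)) i.2)).mono
      (past_le_tossPast X Y k) le_rfl
  rw [eB]
  refine abs_real_inter_sub_le_of_isStep (h.tossPast_le _) (measurable_tossPast X Y (k + 1)) hV
    hstep' hB (fun C hC => ?_) hA
  have hC' : MeasurableSet (X (k + 1) ⁻¹' C) := hXm _ hC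
  -- Both measures have mass μ(X_{k+1} ∈ C), so neither need be a probability; their distance is a
  -- supremum of covariances of X at lag l.
  have htv : tvDist ((μ.restrict (X (k + 1) ⁻¹' C)).map (X n))
      (μ (X (k + 1) ⁻¹' C) • μ.map (X n)) ≤ ENNReal.ofReal (mixingCoeff μ X l) := by
    refine iSup₂_le fun D hD => ENNReal.ofReal_le_ofReal ?_
    rw [measureReal_ennreal_smul_apply, map_measureReal_apply (hXm n) hD,
      map_measureReal_apply (hXm n) hD, measureReal_restrict_apply (hXm n hD), Set.inter_comm]
    refine le_mixingCoeff (k := k + 1) (l := l) ?_ ?_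
    · exact le_iSup (fun i : {i : ℕ // i ≤ k + 1} => mE.comap (X i)) ⟨k + 1, le_rfl⟩ _ ⟨C, hC, rfl⟩
    · exact le_iSup (fun i : {i : ℕ // k + 1 + l ≤ i} => mE.comap (X i)) ⟨n, le_rfl⟩ _
        ⟨D, hD, rfl⟩
  have hfm : IsFiniteMeasure (μ (X (k + 1) ⁻¹' C) • μ.map (X n)) :=
    Measure.smul_finite _ (measure_ne_top _ _)
  have h1 := lintegral_le_of_tvDist_le htv (f := fun x => (pathKernel a.splitKernel ∘ₖ a.toss) x B)
    (Kernel.measurable_coe _ hB) fun x => prob_le_one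
  rw [lintegral_smul_measure, lintegral_map (Kernel.measurable_coe _ hB) (hXm n),
    lintegral_map (Kernel.measurable_coe _ hB) (hXm n),
    ← hstep.measure_inter (hXm n) hV
      (tossPast_mono X Y (Nat.le_add_right (k + 1) l) _ (measurable_tossPast X Y (k + 1) hC)) hB,
    ← setLIntegral_univ, ← hstep.measure_inter (hXm n) hV MeasurableSet.univ hB, Set.univ_inter,
    smul_eq_mul] at h1
  have hfm' : IsFiniteMeasure (μ (X (k + 1) ⁻¹' C) • μ) :=
    Measure.smul_finite _ (measure_ne_top _ _)
  have h2 := (ofReal_abs_sub_le_iff (κ := μ.restrict (X (k + 1) ⁻¹' C))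
    (η := μ (X (k + 1) ⁻¹' C) • μ) (D := ENNReal.ofReal (mixingCoeff μ X l)) (V ⁻¹' B)).2 (by
      rwa [Measure.restrict_apply (hV hB), Set.inter_comm, Measure.smul_apply, smul_eq_mul])
  rw [ENNReal.ofReal_le_ofReal_iff (mixingCoeff_nonneg l), measureReal_restrict_apply (hV hB),
    Set.inter_comm, measureReal_ennreal_smul_apply] at h2
  exact h2

end CoinMixing

/-! ### Moments of the first joint regeneration -/

section Moments

theorem tendsto_zero_of_triple_le {v α : ℕ → ℝ} (hv : Antitone v) (hv0 : ∀ n, 0 ≤ v n)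
    (hv1 : v 1 < 1) (h3 : ∀ m, 1 ≤ m → v (3 * m) ≤ v m ^ 2 + α m)
    (hα : Tendsto α atTop (𝓝 0)) : Tendsto v atTop (𝓝 0) := by
  obtain ⟨L, hL⟩ : ∃ L, Tendsto v atTop (𝓝 L) :=
    ⟨_, tendsto_atTop_ciInf hv ⟨0, by rintro _ ⟨n, rfl⟩; exact hv0 n⟩⟩
  have hL0 : 0 ≤ L := ge_of_tendsto' hL hv0
  have hL1 : L ≤ v 1 := le_of_tendsto hL (eventually_atTop.2 ⟨1, fun n hn => hv hn⟩)
  -- Passing to the limit gives L ≤ L², and 0 ≤ L < 1 leaves only L = 0.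
  have h4 : L ≤ L ^ 2 + 0 :=
    le_of_tendsto_of_tendsto
      (hL.comp (tendsto_id.const_mul_atTop' (r := 3) (by norm_num))) ((hL.pow 2).add hα)
      (eventually_atTop.2 ⟨1, fun n hn => h3 n hn⟩)
  have : L = 0 := by nlinarith
  rwa [this] at hL

theorem sum_range_three_mul_add (f : ℕ → ℝ) (N : ℕ) :
    ∑ n ∈ Finset.range (3 * N + 3), f n = ∑ n ∈ Finset.range 3, f n +
      ∑ m ∈ Finset.range N, (f (3 * m + 3) + f (3 * m + 4) + f (3 * m + 5)) := by
  induction N with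
  | zero => simp
  | succ N ih =>
    rw [show 3 * (N + 1) + 3 = 3 * N + 3 + 1 + 1 + 1 by ring, Finset.sum_range_succ,
      Finset.sum_range_succ, Finset.sum_range_succ, ih, Finset.sum_range_succ _ N]
    ring

/-- With partial sums S of n ↦ (n + 1)^p v(n), the recursion gives S(3N + 3) ≤ C + S(N)/2. As S(N) ≤
S(3N + 3), the partial sums are at most 2C. -/
theorem summable_pow_mul_of_triple_le {v α : ℕ → ℝ} (hv : Antitone v) (hv0 : ∀ n, 0 ≤ v n)
    (hv1 : v 1 < 1) (hα0 : ∀ n, 0 ≤ α n)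
    (h3 : ∀ m, 1 ≤ m → v (3 * m) ≤ v m ^ 2 + α m) (p : ℕ)
    (hα : Summable fun l : ℕ => ((l + 1 : ℕ) : ℝ) ^ p * α (l + 1)) :
    Summable fun n : ℕ => ((n + 1 : ℕ) : ℝ) ^ p * v n := by
  have hαlim : Tendsto α atTop (𝓝 0) := by
    rw [← tendsto_add_atTop_iff_nat 1]
    refine squeeze_zero (fun n => hα0 _) (fun n => ?_) hα.tendsto_atTop_zero
    refine le_mul_of_one_le_left (hα0 _) (one_le_pow₀ ?_)
    exact_mod_cast Nat.le_add_left 1 n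
  have hlim := tendsto_zero_of_triple_le hv hv0 hv1 h3 hαlim
  -- Three residues modulo 3, each costing 6^p from 3m + 3 + r + 1 ≤ 6(m + 1). Past m₀ one has v ≤
  -- 1/(2Q), so the quadratic terms contribute at most half of the original sum.
  set Q : ℝ := 3 * 6 ^ p with hQ
  have hQ0 : 0 < Q := by positivity
  obtain ⟨m₀, hm₀⟩ := eventually_atTop.1 (hlim.eventually_le_const (u := 1 / (2 * Q)) (by positivity))
  have hone : ∀ m, v (m + 1) ≤ 1 := fun m => (hv (Nat.le_add_left 1 m)).trans hv1.le
  have hsq : ∀ m, v (m + 1) ^ 2 ≤ 1 / (2 * Q) * v m + if m < m₀ then 1 else 0 := fun m => by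
    split_ifs with hm
    · have : 0 ≤ 1 / (2 * Q) * v m := mul_nonneg (by positivity) (hv0 m)
      have : v (m + 1) ^ 2 ≤ 1 := pow_le_one₀ (hv0 _) (hone m)
      linarith
    · rw [pow_two, add_zero]
      exact mul_le_mul (hm₀ _ (by omega)) (hv (Nat.le_succ m)) (hv0 _) (by positivity)
  set f : ℕ → ℝ := fun n => ((n + 1 : ℕ) : ℝ) ^ p * v n with hf
  have hf0 : ∀ n, 0 ≤ f n := fun n => mul_nonneg (by positivity) (hv0 n)
  have hblock : ∀ m r : ℕ, r < 3 → f (3 * m + 3 + r) ≤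
      6 ^ p * (((m + 1 : ℕ) : ℝ) ^ p * (v (m + 1) ^ 2 + α (m + 1))) := fun m r hr => by
    have h1 : v (3 * m + 3 + r) ≤ v (m + 1) ^ 2 + α (m + 1) :=
      (hv (by omega : 3 * (m + 1) ≤ 3 * m + 3 + r)).trans (h3 (m + 1) (Nat.le_add_left 1 m))
    have h2 : ((3 * m + 3 + r + 1 : ℕ) : ℝ) ^ p ≤ 6 ^ p * ((m + 1 : ℕ) : ℝ) ^ p := by
      rw [← mul_pow]
      refine pow_le_pow_left₀ (by positivity) ?_ p
      exact_mod_cast (by omega : 3 * m + 3 + r + 1 ≤ 6 * (m + 1))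
    rw [← mul_assoc]
    exact mul_le_mul h2 h1 (hv0 _) (by positivity)
  set M₀ : ℝ := ∑ m ∈ Finset.range m₀, ((m + 1 : ℕ) : ℝ) ^ p with hM₀
  set Cα : ℝ := ∑' l : ℕ, ((l + 1 : ℕ) : ℝ) ^ p * α (l + 1) with hCα
  have hbound : ∀ N, ∑ n ∈ Finset.range (3 * N + 3), f n ≤
      ∑ n ∈ Finset.range 3, f n + (1 / 2 * ∑ n ∈ Finset.range N, f n + Q * (M₀ + Cα)) := fun N => by
    rw [sum_range_three_mul_add]
    gcongr
    have h1 : ∀ m, f (3 * m + 3) + f (3 * m + 4) + f (3 * m + 5) ≤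
        1 / 2 * f m + Q * ((((m + 1 : ℕ) : ℝ) ^ p * if m < m₀ then 1 else 0) +
          ((m + 1 : ℕ) : ℝ) ^ p * α (m + 1)) := fun m => by
      have e0 := hblock m 0 (by norm_num)
      have e1 := hblock m 1 (by norm_num)
      have e2 := hblock m 2 (by norm_num)
      have h4 : Q * (((m + 1 : ℕ) : ℝ) ^ p * (v (m + 1) ^ 2 + α (m + 1))) ≤
          Q * (((m + 1 : ℕ) : ℝ) ^ p *
            ((1 / (2 * Q) * v m + if m < m₀ then 1 else 0) + α (m + 1))) := by
        gcongr
        exact hsq m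
      have h5 : Q * (((m + 1 : ℕ) : ℝ) ^ p *
            ((1 / (2 * Q) * v m + if m < m₀ then 1 else 0) + α (m + 1))) =
          1 / 2 * f m + Q * ((((m + 1 : ℕ) : ℝ) ^ p * if m < m₀ then 1 else 0) +
          ((m + 1 : ℕ) : ℝ) ^ p * α (m + 1)) := by
        simp only [hf]
        field_simp
        ring
      rw [hQ] at h4 h5 ⊢
      simp only [add_zero, add_assoc, Nat.reduceAdd] at e0 e1 e2 h4 h5 ⊢
      linarith
    refine (Finset.sum_le_sum fun m _ => h1 m).trans ?_
    rw [Finset.sum_add_distrib, ← Finset.mul_sum, ← Finset.mul_sum, Finset.sum_add_distrib]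
    gcongr
    · simp only [mul_ite, mul_one, mul_zero]
      rw [← Finset.sum_filter, hM₀]
      refine Finset.sum_le_sum_of_subset_of_nonneg (fun m hm => ?_) fun _ _ _ => by positivity
      simpa using (Finset.mem_filter.1 hm).2
    · exact hα.sum_le_tsum _ fun l _ => mul_nonneg (by positivity) (hα0 _)
  refine summable_of_sum_range_le hf0
    (c := 2 * (∑ n ∈ Finset.range 3, f n + Q * (M₀ + Cα))) fun N => ?_
  have h1 : ∑ n ∈ Finset.range N, f n ≤ ∑ n ∈ Finset.range (3 * N + 3), f n :=
    Finset.sum_le_sum_of_subset_of_nonneg (Finset.range_mono (by omega)) fun n _ _ => hf0 n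
  have h2 := hbound N
  linarith

theorem succ_pow_succ_le (n p : ℕ) :
    (n + 1) ^ (p + 1) ≤ n ^ (p + 1) + (p + 1) * (n + 1) ^ p := by
  induction p with
  | zero => simp
  | succ p ih =>
    have h1 : (n + 1) ^ (p + 2) = n * (n + 1) ^ (p + 1) + (n + 1) ^ (p + 1) := by ring
    have h2 : n * (n + 1) ^ (p + 1) ≤ n * (n ^ (p + 1) + (p + 1) * (n + 1) ^ p) :=
      Nat.mul_le_mul_left n ih
    have h3 : n * ((p + 1) * (n + 1) ^ p) ≤ (n + 1) * ((p + 1) * (n + 1) ^ p) :=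
      Nat.mul_le_mul_right _ (Nat.le_succ n)
    calc (n + 1) ^ (p + 1 + 1) ≤ n * (n ^ (p + 1) + (p + 1) * (n + 1) ^ p) + (n + 1) ^ (p + 1) := by
          rw [h1]; omega
      _ ≤ n * n ^ (p + 1) + (n + 1) * ((p + 1) * (n + 1) ^ p) + (n + 1) ^ (p + 1) := by
          rw [mul_add]; omega
      _ = _ := by ring

theorem pow_succ_le_sum (N p : ℕ) :
    N ^ (p + 1) ≤ ∑ n ∈ Finset.range N, (p + 1) * (n + 1) ^ p := by
  induction N with
  | zero => simp
  | succ N ih =>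
    rw [Finset.sum_range_succ]
    exact (succ_pow_succ_le N p).trans (Nat.add_le_add_right ih _)

/-- A discrete tail formula: T^{p+1} ≤ ∑_{n < T} (p + 1)(n + 1)^p, and n < T means that V vanishes
at 0, …, n. -/
theorem iInf_pow_succ_le_tsum {Ω : Type*} (V : ℕ → Ω → Bool) (p : ℕ) (ω : Ω) :
    (⨅ (j : ℕ) (_ : V j ω = true), (j : ℝ≥0∞)) ^ (p + 1) ≤
      ∑' n : ℕ, (((p + 1) * (n + 1) ^ p : ℕ) : ℝ≥0∞) *
        {ω | ∀ j < n + 1, V (0 + j) ω = false}.indicator 1 ω := by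
  by_cases h : ∃ j, V j ω = true
  · classical
    have hmin : ∀ j < Nat.find h, V j ω = false := fun j hj => by
      simpa using Nat.find_min h hj
    calc (⨅ (j : ℕ) (_ : V j ω = true), (j : ℝ≥0∞)) ^ (p + 1)
        ≤ ((Nat.find h : ℕ) : ℝ≥0∞) ^ (p + 1) :=
          pow_le_pow_left' (iInf₂_le (f := fun (j : ℕ) (_ : V j ω = true) => (j : ℝ≥0∞)) _
            (Nat.find_spec h)) _
      _ ≤ ((∑ n ∈ Finset.range (Nat.find h), (p + 1) * (n + 1) ^ p : ℕ) : ℝ≥0∞) := by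
          exact_mod_cast pow_succ_le_sum (Nat.find h) p
      _ = ∑ n ∈ Finset.range (Nat.find h), (((p + 1) * (n + 1) ^ p : ℕ) : ℝ≥0∞) *
            {ω | ∀ j < n + 1, V (0 + j) ω = false}.indicator 1 ω := by
          rw [Nat.cast_sum]
          refine Finset.sum_congr rfl fun n hn => ?_
          have hn' := Finset.mem_range.1 hn
          rw [Set.indicator_of_mem, Pi.one_apply, mul_one]
          intro j hj
          rw [zero_add]
          exact hmin j (by omega)
      _ ≤ _ := ENNReal.sum_le_tsum _
  · push Not at h
    -- If V never takes the value `true`, the infimum is ∞, but every term of the series is at least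
    -- 1.
    have : ∑' n : ℕ, (((p + 1) * (n + 1) ^ p : ℕ) : ℝ≥0∞) *
        {ω | ∀ j < n + 1, V (0 + j) ω = false}.indicator 1 ω = ∞ := by
      refine top_unique ((ENNReal.tsum_const_eq_top_of_ne_zero (α := ℕ) one_ne_zero).ge.trans ?_)
      refine ENNReal.tsum_le_tsum fun n => ?_
      rw [Set.indicator_of_mem (by intro j _; simpa using h (0 + j)), Pi.one_apply, mul_one]
      exact_mod_cast Nat.succ_le_of_lt (by positivity)
    rw [this]
    exact le_top

variable {Ω : Type*} [mΩ : MeasurableSpace Ω] {μ : Measure Ω} [IsProbabilityMeasure μ]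
  {V : ℕ → Ω → Bool}

/-- The probability that `V` vanishes at the `m` consecutive times from `i` on. -/
noncomputable def vanishProb (μ : Measure Ω) (V : ℕ → Ω → Bool) (i m : ℕ) : ℝ :=
  μ.real {ω | ∀ j < m, V (i + j) ω = false}

/-- Only the outer two of three blocks are kept; the first ends at i + m - 1 and the last starts at
i + 2m, a lag of m + 1. -/
theorem vanishProb_triple_le (V : ℕ → Ω → Bool) (i : ℕ) {m : ℕ} (hm : 1 ≤ m) :
    vanishProb μ V i (3 * m) ≤
      vanishProb μ V i m * vanishProb μ V (i + 2 * m) m + mixingCoeff μ V (m + 1) := by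
  set A : Set Ω := {ω | ∀ j < m, V (i + j) ω = false} with hA
  set B : Set Ω := {ω | ∀ j < m, V (i + 2 * m + j) ω = false} with hB
  have e : ∀ q : ℕ, {ω | ∀ j < m, V (q + j) ω = false} =
      ⋂ j ∈ Finset.range m, V (q + j) ⁻¹' {false} := fun q => by ext; simp
  have hAm : MeasurableSet[⨆ j : {j : ℕ // j ≤ i + (m - 1)}, MeasurableSpace.comap (V j) ⊤] A := by
    rw [hA, e]
    refine Finset.measurableSet_biInter _ fun j hj => ?_
    have hj' := Finset.mem_range.1 hj
    exact le_iSup (fun j : {j : ℕ // j ≤ i + (m - 1)} => MeasurableSpace.comap (V j) ⊤)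
      ⟨i + j, by omega⟩ _ ⟨{false}, trivial, rfl⟩
  have hBm : MeasurableSet[⨆ j : {j : ℕ // i + (m - 1) + (m + 1) ≤ j},
      MeasurableSpace.comap (V j) ⊤] B := by
    rw [hB, e]
    refine Finset.measurableSet_biInter _ fun j hj => ?_
    exact le_iSup (fun j : {j : ℕ // i + (m - 1) + (m + 1) ≤ j} => MeasurableSpace.comap (V j) ⊤)
      ⟨i + 2 * m + j, by omega⟩ _ ⟨{false}, trivial, rfl⟩
  have h1 := (abs_le.1 (le_mixingCoeff (μ := μ) (Z := V) hAm hBm)).2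
  have h2 : vanishProb μ V i (3 * m) ≤ μ.real (A ∩ B) := by
    refine measureReal_mono (fun ω hω => ⟨fun j hj => hω j (by omega), fun j hj => ?_⟩)
    rw [add_assoc]
    exact hω (2 * m + j) (by omega)
  have h3 : vanishProb μ V i m * vanishProb μ V (i + 2 * m) m = μ.real A * μ.real B := rfl
  linarith

theorem summable_vanishProb {α : ℕ → ℝ} (hα0 : ∀ n, 0 ≤ α n)
    (hmix : ∀ m, mixingCoeff μ V (m + 1) ≤ α m) {c : ℝ} (hc : c < 1)
    (hV : ∀ i, μ.real {ω | V i ω = false} ≤ c) (p : ℕ)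
    (hα : Summable fun l : ℕ => ((l + 1 : ℕ) : ℝ) ^ p * α (l + 1)) :
    Summable fun n : ℕ => ((n + 1 : ℕ) : ℝ) ^ p * vanishProb μ V 0 n := by
  have h0 : ∀ i m, 0 ≤ vanishProb μ V i m := fun i m => measureReal_nonneg
  have hbdd : ∀ m, BddAbove (Set.range fun i => vanishProb μ V i m) := fun m =>
    ⟨1, by rintro _ ⟨i, rfl⟩; exact measureReal_le_one⟩
  -- The supremum over starting times makes the recursion close without stationarity of V.
  set v : ℕ → ℝ := fun m => ⨆ i, vanishProb μ V i m with hv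
  have hle : ∀ i m, vanishProb μ V i m ≤ v m := fun i m => le_ciSup (hbdd m) i
  have hv0 : ∀ m, 0 ≤ v m := fun m => (h0 0 m).trans (hle 0 m)
  have hanti : Antitone v := fun m n hmn => ciSup_le fun i =>
    le_trans (show vanishProb μ V i n ≤ vanishProb μ V i m from
      measureReal_mono fun ω hω j hj => hω j (lt_of_lt_of_le hj hmn)) (hle i m)
  have hv1 : v 1 < 1 := by
    refine lt_of_le_of_lt (ciSup_le fun i => ?_) hc
    refine le_trans (measureReal_mono fun ω hω => ?_) (hV i)
    exact hω 0 one_pos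
  have h3 : ∀ m, 1 ≤ m → v (3 * m) ≤ v m ^ 2 + α m := fun m hm => ciSup_le fun i => by
    refine (vanishProb_triple_le V i hm).trans (add_le_add ?_ (hmix m))
    rw [pow_two]
    exact mul_le_mul (hle _ _) (hle _ _) (h0 _ _) (hv0 _)
  refine Summable.of_nonneg_of_le (fun n => mul_nonneg (by positivity) (h0 0 n)) (fun n => ?_)
    (summable_pow_mul_of_triple_le hanti hv0 hv1 hα0 h3 p hα)
  exact mul_le_mul_of_nonneg_left (hle 0 n) (by positivity)

theorem lintegral_iInf_pow_lt_top (hVm : ∀ n, Measurable (V n)) (p : ℕ)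
    (hs : Summable fun n : ℕ => ((n + 1 : ℕ) : ℝ) ^ p * vanishProb μ V 0 n) :
    ∫⁻ ω, (⨅ (j : ℕ) (_ : V j ω = true), (j : ℝ≥0∞)) ^ (p + 1) ∂μ < ∞ := by
  have hm : ∀ n, MeasurableSet {ω | ∀ j < n, V (0 + j) ω = false} := fun n => by
    have : {ω | ∀ j < n, V (0 + j) ω = false} =
        ⋂ j ∈ Finset.range n, V (0 + j) ⁻¹' {false} := by ext; simp
    rw [this]
    exact Finset.measurableSet_biInter _ fun j _ => hVm _ (measurableSet_singleton false)
  refine lt_of_le_of_lt (lintegral_mono (iInf_pow_succ_le_tsum V p)) ?_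
  rw [lintegral_tsum fun n => ((measurable_one.indicator (hm (n + 1))).const_mul _).aemeasurable]
  refine lt_of_le_of_lt (ENNReal.tsum_le_tsum fun n => ?_)
    (lt_top_iff_ne_top.2 (hs.mul_left ((p + 1 : ℕ) : ℝ)).tsum_ofReal_ne_top)
  rw [lintegral_const_mul _ (measurable_one.indicator (hm (n + 1))),
    lintegral_indicator_one (hm (n + 1)), vanishProb, ← mul_assoc,
    ENNReal.ofReal_mul (by positivity), ofReal_measureReal, ← Nat.cast_pow, ← Nat.cast_mul,
    ENNReal.ofReal_natCast]
  gcongr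
  omega

end Moments

/-! ### The theorem -/

section Main

variable {E : Type*} [MeasurableSpace E] {P : Kernel E E} {π : Measure E}

/-- If π(A) = 0, invariance gives P^n(x, A) = 0 for all n at π-almost every x, against
irreducibility. -/
theorem measure_pos_of_isIrreducible [IsProbabilityMeasure π] {φ : Measure E} (h : Kernel.IsIrreducible φ P)
    (hπ : Kernel.Invariant P π) {A : Set E} (hA : MeasurableSet A) (hφ : 0 < φ A) : 0 < π A := by
  refine pos_iff_ne_zero.2 fun h0 => ?_
  have h1 : ∀ n : ℕ, ∀ᵐ x ∂π, (P ^ n) x A = 0 := fun n => by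
    have h2 : ∫⁻ x, (P ^ n) x A ∂π = 0 := by
      rw [← Measure.bind_apply hA (Kernel.aemeasurable _), (hπ.pow n).def, h0]
    exact (lintegral_eq_zero_iff ((P ^ n).measurable_coe hA)).1 h2
  obtain ⟨x, hx⟩ := (ae_all_iff.2 h1).exists
  obtain ⟨n, hn⟩ := h.irreducible hA hφ x
  exact hn.ne' (hx n)

variable [IsMarkovKernel P] {Ω : Type*} [mΩ : MeasurableSpace Ω] {μ : Measure Ω} [IsProbabilityMeasure μ] {a : Atom P}
  {X : ℕ → Ω → E} {Y : ℕ → Ω → Bool}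

theorem IsSplitChain.measure_coin_false_lt_one (h : IsSplitChain a μ X Y)
    (h0 : μ.map (X 0) = π) (hpos : 0 < π {x | 0 < a.s x}) : μ.real {ω | Y 0 ω = false} < 1 := by
  have hm : MeasurableSet {ω | Y 0 ω = true} := h.measurable_snd 0 (measurableSet_singleton true)
  have h1 : μ {ω | Y 0 ω = true} = ∫⁻ x, a.s x ∂π := by
    have h2 := (h.step_coin 0).measure_inter (h.measurable_fst 0) (h.measurable_snd 0)
      MeasurableSet.univ (measurableSet_singleton true)
    rw [Set.univ_inter, Measure.restrict_univ,
      ← lintegral_map (a.coin.measurable_coe (measurableSet_singleton true)) (h.measurable_fst 0),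
      h0] at h2
    simp only [Atom.coin] at h2
    refine Eq.trans ?_ (h2.trans (lintegral_congr fun x => by simp))
    rfl
  have h2 : 0 < μ {ω | Y 0 ω = true} := by
    rw [h1, lintegral_pos_iff_support a.measurable_s]
    simpa [Function.support, pos_iff_ne_zero] using hpos
  have h3 : {ω | Y 0 ω = false} = {ω | Y 0 ω = true}ᶜ := by ext; simp
  rw [h3, probReal_compl_eq_one_sub hm]
  have : 0 < μ.real {ω | Y 0 ω = true} := ENNReal.toReal_pos h2.ne' (measure_ne_top _ _)
  linarith

/-- For each frozen time the stationary marginal is the same, so sampling at an independent random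
time does not change it. -/
theorem real_embedded_singleton {Y Y' : ℕ → Ω → Bool} (hY : ∀ n, Measurable (Y n))
    (hY' : ∀ n, Measurable (Y' n)) (hs : HasStationaryLaw μ Y')
    (hi : IndepFun (fun ω n => regTime Y n ω) (fun ω n => Y' n ω) μ) (i : ℕ) (b : Bool) :
    μ.real {ω | embedded Y Y' i ω = b} = μ.real {ω | Y' 0 ω = b} := by
  have hC : MeasurableSet {z : ℕ → Bool | z i = b} :=
    measurable_pi_apply (X := fun _ : ℕ => Bool) i (measurableSet_singleton b)
  refine (real_embedded hY hY' hi hC).trans ?_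
  have : ∀ t : ℕ → ℕ, sampledProb μ Y' {z : ℕ → Bool | z i = b} t = μ.real {ω | Y' 0 ω = b} :=
    fun t => hs.sampledProb_add (C := {z : ℕ → Bool | z i = b}) hY' hC (t i) 0 ▸ rfl
  simp [this]

end Main

theorem lemma3p3
    {Ω E₁ E₂ : Type*} [MeasurableSpace Ω] [MeasurableSpace E₁] [MeasurableSpace E₂]
    -- the transition probabilities of `{X_t}` and `{W_t}`, and their atoms
    (P₁ : Kernel E₁ E₁) [IsMarkovKernel P₁] (a₁ : Atom P₁)
    (P₂ : Kernel E₂ E₂) [IsMarkovKernel P₂] (a₂ : Atom P₂)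
    -- `{X_t}` is Harris recurrent and `s₁` is nontrivial
    (φ₁ : Measure E₁) (hX : IsHarrisRecurrent P₁ φ₁) (hs₁ : 0 < φ₁ {x | 0 < a₁.s x})
    -- `{W_t}` is irreducible and ergodic with stationary law `π₂`, and `s₂` is nontrivial
    (φ₂ : Measure E₂) (hW : IsPhiIrreducible P₂ φ₂) (hs₂ : 0 < φ₂ {w | 0 < a₂.s w})
    (π₂ : Measure E₂) [IsProbabilityMeasure π₂] (hπ₂ : IsErgodicKernel P₂ π₂)
    -- the two split chains, independent of each other
    (μ : Measure Ω) [IsProbabilityMeasure μ]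
    (X : ℕ → Ω → E₁) (Y₁ : ℕ → Ω → Bool) (W : ℕ → Ω → E₂) (Y₂ : ℕ → Ω → Bool)
    (hXY : IsSplitChain a₁ μ X Y₁) (hWY : IsSplitChain a₂ μ W Y₂)
    (hindep : IndepFun (fun ω t => (X t ω, Y₁ t ω)) (fun ω t => (W t ω, Y₂ t ω)) μ) :
    -- geometric ergodicity
    (IsGeometricallyErgodic P₂ π₂ →
      IsMarkovChain μ (embedded Y₁ W) (embeddedKernel a₁ P₂) ∧
        IsGeometricallyErgodic (embeddedKernel a₁ P₂) π₂) ∧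
    -- the stationary case `λ = λ₁ ⊗ π₂`
    (μ.map (W 0) = π₂ →
      (IsStronglyMixing μ W →
        IsStronglyMixing μ (embedded Y₁ W) ∧
          ∀ l : ℕ, mixingCoeff μ (embedded Y₁ W) l ≤ mixingCoeff μ W l) ∧
      ∀ p : ℕ, Summable (fun l : ℕ => ((l + 1 : ℕ) : ℝ) ^ p * mixingCoeff μ W (l + 1)) →
        ∫⁻ ω, firstJointRegen Y₁ Y₂ ω ^ (p + 1) ∂μ < ∞) := by
  have hrec := hXY.ae_frequently_true hX hs₁
  have hρ := hXY.isProbabilityMeasure_gapLaw hrec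
  have hY₁ := hXY.measurable_snd
  have hY₂ := hWY.measurable_snd
  have hWm := hWY.measurable_fst
  have hτm : Measurable fun (p : ℕ → E₁ × Bool) n => regTime (fun t p => (p t).2) n p :=
    measurable_pi_lambda _ (measurable_regTime fun t => measurable_snd.comp (measurable_pi_apply t))
  have hWi : IndepFun (fun ω n => regTime Y₁ n ω) (fun ω n => W n ω) μ :=
    hindep.comp (ψ := fun (p : ℕ → E₂ × Bool) n => (p n).1) hτm
      (measurable_pi_lambda _ fun n => measurable_fst.comp (measurable_pi_apply n))
  have hYi : IndepFun (fun ω n => regTime Y₁ n ω) (fun ω n => Y₂ n ω) μ :=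
    hindep.comp (ψ := fun (p : ℕ → E₂ × Bool) n => (p n).2) hτm
      (measurable_pi_lambda _ fun n => measurable_snd.comp (measurable_pi_apply n))
  refine ⟨fun hgeo => ⟨hXY.isMarkovChain_embedded hrec hWY.isMarkovWrt_tossPast hWi,
    isGeometricallyErgodic_embeddedKernel a₁ hgeo⟩, fun h0 => ?_⟩
  have hst := hWY.hasStationaryLaw hπ₂.1 h0
  have hle : ∀ l, mixingCoeff μ (embedded Y₁ W) l ≤ mixingCoeff μ W l :=
    hXY.mixingCoeff_embedded_le hrec hWm (hst.comp hWY.chain.measurable measurable_fst) hWi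
  have hst₂ : HasStationaryLaw μ Y₂ := hst.comp hWY.chain.measurable measurable_snd
  refine ⟨fun hmix => ⟨squeeze_zero (fun l => mixingCoeff_nonneg l) hle hmix, hle⟩,
    fun p hp => ?_⟩
  refine lintegral_iInf_pow_lt_top (V := embedded Y₁ Y₂) (measurable_embedded hY₁ hY₂) p
    (summable_vanishProb (α := mixingCoeff μ W) (fun n => mixingCoeff_nonneg n) (fun m => ?_)
      (hWY.measure_coin_false_lt_one h0 ?_) (fun i => ?_) p hp)
  -- The unit of lag lost in passing from positions to coins is exactly the one gained by the block
  -- separation m + 1.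
  · exact (hXY.mixingCoeff_embedded_le hrec hY₂ hst₂ hYi (m + 1)).trans
      (hWY.mixingCoeff_coin_le m)
  · exact measure_pos_of_isIrreducible hW.2 hπ₂.1
      (measurableSet_lt measurable_const a₂.measurable_s) hs₂
  · exact (real_embedded_singleton hY₁ hY₂ hst₂ hYi i false).le
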